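/- **Setting.** There are $N$ agents. At each time $t=0,1,2,\dots$ they communicate over a directed graph with edge set $\mathcal E_t$ containing all self-loops, with adjacency matrix $A_t=(a_{ij,t})$, where $a_{ij,t}>0$ if $(j,i)\in\mathcal E_t$ and $a_{ij,t}=0$ otherwise. Assume: (i) there is $a\in(0,1)$ such that every nonzero $a_{ij,t}$ is at least $a$; (ii) $\sum_{i}a_{ij,t}=1$ for all $j$ and $\sum_j a_{ij,t}\le 1$ for all $i$; (iii) there is an integer $Q>0$ such that for every $t\ge1$ the graph with edge set $\bigcup_{l=0}^{Q-1}\mathcal E_{t+l}$ is strongly connected. Agent $i$ has a convex compact set $X_i\subset\mathbb R^{n_i}$, proper convex costs $f_{i,t}:\mathbb R^{n_i}\to\mathbb R\cup\{\pm\infty\}$ $(t\ge0)$ and a function $g_i:\mathbb R^{n_i}\to(\mathbb R\cup\{\pm\infty\})^m$ with proper convex components. The set $X_i$ lies in the interior of the set where $f_{i,t}$ is finite and in the interior of the set where $g_i$ is finite (automatic for real-valued functions). There are constants $B_f,C_f$ with $|f_{i,t}(x)|\le B_f$ and $\|s\|\le C_f$ for all $i$, $t\ge0$, $x\in X_i$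 and all subgradients $s\in\partial f_{i,t}(x)$. The set $\mathcal X=\{x\in\prod_iX_i:\sum_i g_i(x_i)\le \mathbf 0\}$ is nonempty. **Algorithm.** Let $\alpha_0=\beta_0=1$ and, for $t\ge1$, $\alpha_t=t^{-1/2}$ and $\beta_t=t^{-\kappa}$ with $\kappa=1/5$. Let $T\ge4$. Start from $w_{i,0}=1$, any $x_{i,0}\in X_i$, $\mu_{i,0}=\mathbf 0$, $y_{i,0}=g_i(x_{i,0})$, and for $t=0,\dots,T-1$ put $$w_{i,t+1}=\sum_j a_{ij,t}w_{j,t},\qquad \hat\mu_{i,t}=\sum_j a_{ij,t}\mu_{j,t},\qquad \hat y_{i,t}=\sum_j a_{ij,t}y_{j,t},$$ $$x_{i,t+1}=P_{X_i}(x_{i,t}-\alpha_t s_{i,t+1}),\qquad \mu_{i,t+1}=\Big[\hat\mu_{i,t}+\alpha_t\Big(\frac{\hat y_{i,t}}{w_{i,t+1}^2}-\beta_t\frac{\hat\mu_{i,t}}{w_{i,t+1}}\Big)\Big]_+,$$ $$y_{i,t+1}=\hat y_{i,t}+g_i(x_{i,t+1})-g_i(x_{i,t}),$$ where $s_{i,t+1}$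 is any element of $\partial f_{i,t}(x_{i,t})+\partial g_i(x_{i,t})\,\hat\mu_{i,t}/w_{i,t+1}$, $P_{X_i}$ is the Euclidean projection onto $X_i$, and $[\cdot]_+$ is the componentwise positive part. **Claim.** For every $T\ge4$ the function $x\mapsto\sum_{t=1}^T\sum_i f_{i,t}(x_i)$ has a minimizer $x^*$ over $\mathcal X$, and $$\mathrm{Reg}(T)=\sum_{t=1}^T\sum_{i=1}^N f_{i,t}(x_{i,t})-\sum_{t=1}^T\sum_{i=1}^N f_{i,t}(x_i^*)=O(T^{9/10}),\qquad \mathrm{Reg}^c(T)=\Big\|\Big[\sum_{t=1}^T\sum_{i=1}^N g_i(x_{i,t})\Big]_+\Big\|=O(T^{9/10}).$$ That is, there is a constant $C>0$, depending only on the graphs, weights, sets and functions above, such that $\mathrm{Reg}(T)\le C\,T^{9/10}$ and $\mathrm{Reg}^c(T)\le C\,T^{9/10}$ for all $T\ge4$, all runs of the algorithm up to time $T$, and all such minimizers $x^*$. -/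

import Mathlib

noncomputable section

namespace DistOnline

open scoped BigOperators

/-- `ℝⁿ` with the Euclidean norm. -/
abbrev E (n : ℕ) : Type := EuclideanSpace ℝ (Fin n)

/-! ### Convex analysis -/

/-- An extended-real-valued function is proper: below `+∞` somewhere and nowhere `-∞`. -/
def IsProper {n : ℕ} (h : E n → EReal) : Prop :=
  (∃ z, h z < ⊤) ∧ ∀ z, ⊥ < h z

/-- Convexity of an extended-real-valued function: its epigraph in `ℝⁿ × ℝ` is convex. -/
def IsConvexFn {n : ℕ} (h : E n → EReal) : Prop :=
  Convex ℝ {p : E n × ℝ | h p.1 ≤ (p.2 : EReal)}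

/-- The subdifferential `∂h(x)`: all `s` with `h(y) ≥ h(x) + ⟨s, y - x⟩` for every `y ∈ ℝⁿ`. -/
def subdifferential {n : ℕ} (h : E n → EReal) (x : E n) : Set (E n) :=
  {s | ∀ y, h x + ((inner ℝ s (y - x) : ℝ) : EReal) ≤ h y}

/-- The set `∂f(x) + ∂g(x) v` for scalar `f` and `ℝᵐ`-valued `g`, where
`∂g(x) v = ∑ₖ vₖ ∂gₖ(x)`. -/
def lagrangianSubgradients {n m : ℕ} (f : E n → EReal) (g : E n → Fin m → EReal)
    (x : E n) (v : E m) : Set (E n) :=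
  {s | ∃ p ∈ subdifferential f x, ∃ q : Fin m → E n,
    (∀ k, q k ∈ subdifferential (fun z => g z k) x) ∧ s = p + ∑ k, v k • q k}

/-- `p` is the projection of `x` onto `S`: a point of `S` at the shortest distance from `x`. -/
def IsProjection {n : ℕ} (S : Set (E n)) (x p : E n) : Prop :=
  p ∈ S ∧ ∀ y ∈ S, ‖x - p‖ ≤ ‖x - y‖

/-- `[z]₊`, the componentwise projection onto the nonnegative orthant. -/
def nonnegPart {m : ℕ} (z : E m) : E m :=
  WithLp.toLp 2 (fun k => max (z k) 0)

/-! ### Communication networks -/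

/-- A time-varying directed communication graph on the agents `Fin N`, with its adjacency
matrices. `edge t j i` means that `(j, i)` is an edge at time `t` (`j` sends to `i`), and
`A t i j` is the weight `a_{ij,t}`, which is positive exactly on the edges. Every agent is its
own neighbour. -/
structure Network (N : ℕ) where
  edge : ℕ → Fin N → Fin N → Prop
  A : ℕ → Matrix (Fin N) (Fin N) ℝ
  self_loop : ∀ t i, edge t i i
  weight_pos : ∀ t i j, edge t j i → 0 < A t i j
  weight_zero : ∀ t i j, ¬ edge t j i → A t i j = 0

/-- The assumptions on the communication graph. -/
structure Network.Admissible {N : ℕ} (G : Network N) : Prop where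
  /-- the nonzero weights are bounded below -/
  lower_bound : ∃ a : ℝ, 0 < a ∧ a < 1 ∧ ∀ t i j, 0 < G.A t i j → a ≤ G.A t i j
  /-- the columns sum to one -/
  col_sum : ∀ t j, ∑ i, G.A t i j = 1
  /-- the rows sum to at most one -/
  row_sum : ∀ t i, ∑ j, G.A t i j ≤ 1
  /-- the union of any `Q` consecutive graphs is strongly connected -/
  connected : ∃ Q : ℕ, 0 < Q ∧ ∀ t, 1 ≤ t → ∀ i j,
    Relation.ReflTransGen (fun u v => ∃ l, l < Q ∧ G.edge (t + l) u v) i j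

/-! ### The online optimization problem -/

/-- The data of the problem with `N` agents and `m` coupled inequality constraints: dimensions
`nᵢ`, local feasible sets `Xᵢ`, local costs `f_{i,t}` and local constraint functions `gᵢ`. -/
structure Problem (N m : ℕ) where
  n : Fin N → ℕ
  X : ∀ i, Set (E (n i))
  f : ∀ i, ℕ → E (n i) → EReal
  g : ∀ i, E (n i) → Fin m → EReal

namespace Problem

variable {N m : ℕ} (P : Problem N m)

/-- The real value `f_{i,t}(x)`; used only at points of `Xᵢ`, where `f_{i,t}` is finite. -/
def fval (i : Fin N) (t : ℕ) (x : E (P.n i)) : ℝ := (P.f i t x).toReal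

/-- The vector `gᵢ(x) ∈ ℝᵐ`; used only at points of `Xᵢ`, where `gᵢ` is finite. -/
def gval (i : Fin N) (x : E (P.n i)) : E m :=
  WithLp.toLp 2 (fun k => (P.g i x k).toReal)

/-- Joint decisions in `∏ᵢ Xᵢ` satisfying the coupled constraint `∑ᵢ gᵢ(xᵢ) ≤ 0`. -/
def feasible : Set (∀ i, E (P.n i)) :=
  {z | (∀ i, z i ∈ P.X i) ∧ ∀ k, (∑ i, P.gval i (z i)) k ≤ 0}

/-- The cost `∑_{t=1}^T ∑ᵢ f_{i,t}(zᵢ)` of a fixed joint decision. -/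
def fixedCost (T : ℕ) (z : ∀ i, E (P.n i)) : ℝ :=
  ∑ t ∈ Finset.Icc 1 T, ∑ i, P.fval i t (z i)

/-- `z` is a best fixed decision in hindsight over the horizon `T`. -/
def IsBestFixed (T : ℕ) (z : ∀ i, E (P.n i)) : Prop :=
  z ∈ P.feasible ∧ ∀ z' ∈ P.feasible, P.fixedCost T z ≤ P.fixedCost T z'

/-- `Reg(T)`, for decisions `x_{i,t}` and the comparator `xs`. -/
def regret (T : ℕ) (x : ℕ → ∀ i, E (P.n i)) (xs : ∀ i, E (P.n i)) : ℝ :=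
  (∑ t ∈ Finset.Icc 1 T, ∑ i, P.fval i t (x t i)) - P.fixedCost T xs

/-- `Regᶜ(T)`, the constraint violation. -/
def violation (T : ℕ) (x : ℕ → ∀ i, E (P.n i)) : ℝ :=
  ‖nonnegPart (∑ t ∈ Finset.Icc 1 T, ∑ i, P.gval i (x t i))‖

/-- The assumptions on the problem. -/
structure Admissible : Prop where
  proper_f : ∀ i t, IsProper (P.f i t)
  proper_g : ∀ i k, IsProper (fun x => P.g i x k)
  convex_f : ∀ i t, IsConvexFn (P.f i t)
  convex_g : ∀ i k, IsConvexFn (fun x => P.g i x k)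
  convex_X : ∀ i, Convex ℝ (P.X i)
  compact_X : ∀ i, IsCompact (P.X i)
  feasible_nonempty : P.feasible.Nonempty
  /-- the costs are finite around the local feasible sets (automatic for real-valued costs) -/
  domain_f : ∀ i t, P.X i ⊆ interior {x | P.f i t x < ⊤}
  /-- the constraint functions are finite around the local feasible sets (automatic for
  real-valued functions) -/
  domain_g : ∀ i, P.X i ⊆ interior {x | ∀ k, P.g i x k < ⊤}
  /-- the costs are bounded on the local feasible sets, uniformly in time -/
  bounded_f : ∃ B : ℝ, ∀ i t, ∀ x ∈ P.X i, |P.fval i t x| ≤ B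
  /-- so are their subgradients -/
  bounded_subgradient_f : ∃ C : ℝ, ∀ i t, ∀ x ∈ P.X i,
    ∀ s ∈ subdifferential (P.f i t) x, ‖s‖ ≤ C

end Problem

/-! ### The distributed online primal-dual push-sum algorithm -/

/-- The stepsizes `α₀ = 1`, `α_t = 1 / √t`. -/
def alpha (t : ℕ) : ℝ := if t = 0 then 1 else 1 / Real.sqrt t

/-- The stepsizes `β₀ = 1`, `β_t = 1 / t^κ`. -/
def beta (κ : ℝ) (t : ℕ) : ℝ := if t = 0 then 1 else 1 / (t : ℝ) ^ κ

/-- The mixed value `∑ⱼ a_{ij,t} zⱼ` that agent `i` forms at time `t`. -/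
def Network.mix {N : ℕ} (G : Network N) (t : ℕ) {m : ℕ} (z : Fin N → E m) (i : Fin N) : E m :=
  ∑ j, G.A t i j • z j

/-- A run of the algorithm up to the horizon `T` (only times `0, …, T` are constrained). The
starting points `x_{i,0} ∈ Xᵢ` and the subgradients `s_{i,t+1}` are arbitrary choices. -/
structure Run {N m : ℕ} (G : Network N) (P : Problem N m) (κ : ℝ) (T : ℕ) where
  x : ℕ → ∀ i, E (P.n i)
  s : ℕ → ∀ i, E (P.n i)
  w : ℕ → Fin N → ℝ
  μ : ℕ → Fin N → E m
  y : ℕ → Fin N → E m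
  w_zero : ∀ i, w 0 i = 1
  x_zero : ∀ i, x 0 i ∈ P.X i
  μ_zero : ∀ i, μ 0 i = 0
  y_zero : ∀ i, y 0 i = P.gval i (x 0 i)
  w_succ : ∀ t, t < T → ∀ i, w (t + 1) i = ∑ j, G.A t i j * w t j
  s_succ : ∀ t, t < T → ∀ i, s (t + 1) i ∈
    lagrangianSubgradients (P.f i t) (P.g i) (x t i) ((w (t + 1) i)⁻¹ • G.mix t (μ t) i)
  x_succ : ∀ t, t < T → ∀ i,
    IsProjection (P.X i) (x t i - alpha t • s (t + 1) i) (x (t + 1) i)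
  μ_succ : ∀ t, t < T → ∀ i, μ (t + 1) i =
    nonnegPart (G.mix t (μ t) i + alpha t •
      ((w (t + 1) i ^ 2)⁻¹ • G.mix t (y t) i
        - beta κ t • (w (t + 1) i)⁻¹ • G.mix t (μ t) i))
  y_succ : ∀ t, t < T → ∀ i, y (t + 1) i =
    G.mix t (y t) i + P.gval i (x (t + 1) i) - P.gval i (x t i)

end DistOnline

end

/-! Column sums one and row sums at most one make every weight matrix doubly stochastic. Hence all
`w` equal 1, mixing preserves means, and the method is a regularized primal-dual subgradient scheme
with consensus.

Fix a feasible `z` and a multiplier `l ≥ 0`, and follow the squared distance of the state to `(z,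
l)`. A step lowers it by `2 α_t` times the Lagrangian gap, up to errors (`Run.descent`). The
trackers `y` stay bounded, so regularization gives `‖μ‖ = O(1/β_t)`, whence `‖s‖ = O(1/β_t)`. The
multipliers disagree only by `O(α_t)`, because products of the weight matrices over long windows
have uniformly positive entries (`Network.Admissible.exists_disagreement_bound`). After division by
`α_t` the errors are `O(α_t/β_t² + ‖l‖² β_t)`.

Summation by parts, with the distance itself `O(1/β_t² + ‖l‖²)`, yields
`Run.exists_lagrangian_bound`: the regret against `z` plus `⟨l, S⟩` is at most `K (T^{9/10} + ‖l‖²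
T^{4/5})`, where `S` is the accumulated constraint vector. Taking `l = 0` bounds the regret. For the
violation take `l = a [S]₊` with `a` of order `T^{-4/5}`: the regret is at least `-O(T)`, so
`‖[S]₊‖² = O(T · T^{4/5}) = O(T^{9/5})`. -/

namespace DistOnline

/-! ### Extended-real-valued convex functions -/

section Convex

variable {n : ℕ} {h : E n → EReal}

theorem IsProper.convexOn_toReal (hp : IsProper h) (hc : IsConvexFn h) :
    ConvexOn ℝ {x | h x < ⊤} (fun x => (h x).toReal) := by
  refine convexOn_of_convex_epigraph ?_
  suffices heq : {p : E n × ℝ | p.1 ∈ {x | h x < ⊤} ∧ (h p.1).toReal ≤ p.2} =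
      {p : E n × ℝ | h p.1 ≤ (p.2 : EReal)} by
    rw [heq]
    exact hc
  ext p
  constructor
  · rintro ⟨h1, h2⟩
    have h1 : h p.1 < ⊤ := h1
    exact (EReal.le_coe_toReal h1.ne).trans (EReal.coe_le_coe_iff.2 h2)
  · intro h1
    have h1 : h p.1 ≤ (p.2 : EReal) := h1
    have h2 : h p.1 < ⊤ := h1.trans_lt (EReal.coe_lt_top _)
    refine ⟨h2, ?_⟩
    rw [← EReal.coe_toReal h2.ne (hp.2 p.1).ne'] at h1
    exact EReal.coe_le_coe_iff.1 h1

theorem subgradient_toReal (hp : IsProper h) {x y s : E n} (hx : h x < ⊤) (hy : h y < ⊤)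
    (hs : s ∈ subdifferential h x) :
    (h x).toReal + inner ℝ s (y - x) ≤ (h y).toReal := by
  have := hs y
  rw [← EReal.coe_toReal hx.ne (hp.2 x).ne', ← EReal.coe_toReal hy.ne (hp.2 y).ne',
    ← EReal.coe_add] at this
  exact EReal.coe_le_coe_iff.1 this

theorem IsProper.continuousOn_toReal (hp : IsProper h) (hc : IsConvexFn h) {S : Set (E n)}
    (hS : S ⊆ interior {x | h x < ⊤}) : ContinuousOn (fun x => (h x).toReal) S :=
  ((hp.convexOn_toReal hc).locallyLipschitzOn_interior.continuousOn).mono hS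

/-- Near an interior point of the domain the function is Lipschitz. Moving from `z` by `e • s`
raises it by at least `e ‖s‖²` and at most `K e ‖s‖`, so `‖s‖ ≤ K`. -/
theorem IsProper.exists_local_subgradient_bound (hp : IsProper h) (hc : IsConvexFn h) {x : E n}
    (hx : x ∈ interior {x | h x < ⊤}) :
    ∃ K : ℝ, ∃ V ∈ nhds x, ∀ z ∈ V, ∀ s ∈ subdifferential h z, ‖s‖ ≤ K := by
  obtain ⟨K, U, hU, hK⟩ := (hp.convexOn_toReal hc).locallyLipschitzOn_interior hx
  rw [nhdsWithin_eq_nhds.2 (isOpen_interior.mem_nhds hx)] at hU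
  refine ⟨K, interior (U ∩ interior {x | h x < ⊤}), interior_mem_nhds.2
    (Filter.inter_mem hU (isOpen_interior.mem_nhds hx)), fun z hz s hs => ?_⟩
  have hcont : Filter.Tendsto (fun e : ℝ => z + e • s) (nhdsWithin 0 (Set.Ioi 0)) (nhds z) := by
    have : Continuous (fun e : ℝ => z + e • s) := by fun_prop
    have := (this.tendsto 0).mono_left (nhdsWithin_le_nhds (s := Set.Ioi 0))
    simpa using this
  obtain ⟨e, hez, he⟩ := ((hcont.eventually (isOpen_interior.mem_nhds hz)).and
    self_mem_nhdsWithin).exists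
  have he : 0 < e := he
  have h1 := interior_subset hz
  have h2 : z + e • s ∈ U ∩ interior {x | h x < ⊤} := interior_subset hez
  have hd : interior {x | h x < ⊤} ⊆ {x | h x < ⊤} := interior_subset
  have h3 := subgradient_toReal hp (hd h1.2) (hd h2.2) hs
  have h4 := hK.dist_le_mul _ h2.1 _ h1.1
  rw [dist_eq_norm, dist_eq_norm, add_sub_cancel_left, norm_smul, Real.norm_eq_abs,
    Real.norm_eq_abs, abs_of_pos he] at h4
  rw [add_sub_cancel_left, inner_smul_right, real_inner_self_eq_norm_sq] at h3
  have h5 : e * ‖s‖ ^ 2 ≤ e * (K * ‖s‖) := by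
    have := (le_abs_self _).trans h4
    nlinarith
  have h6 := le_of_mul_le_mul_left h5 he
  rcases (norm_nonneg s).eq_or_lt with h0 | h0
  · rw [← h0]; positivity
  · rw [sq] at h6
    exact le_of_mul_le_mul_right h6 h0

theorem IsProper.exists_subgradient_bound (hp : IsProper h) (hc : IsConvexFn h) {S : Set (E n)}
    (hcpt : IsCompact S) (hS : S ⊆ interior {x | h x < ⊤}) :
    ∃ K : ℝ, ∀ z ∈ S, ∀ s ∈ subdifferential h z, ‖s‖ ≤ K := by
  refine hcpt.induction_on (p := fun S => ∃ K : ℝ, ∀ z ∈ S, ∀ s ∈ subdifferential h z, ‖s‖ ≤ K)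
    ⟨0, by simp⟩ ?_ ?_ ?_
  · rintro s t hst ⟨K, hK⟩
    exact ⟨K, fun z hz => hK z (hst hz)⟩
  · rintro s t ⟨K, hK⟩ ⟨L, hL⟩
    refine ⟨max K L, fun z hz q hq => ?_⟩
    rcases hz with hz | hz
    · exact (hK z hz q hq).trans (le_max_left _ _)
    · exact (hL z hz q hq).trans (le_max_right _ _)
  · intro x hx
    obtain ⟨K, V, hV, hK⟩ := hp.exists_local_subgradient_bound hc (hS hx)
    exact ⟨V, mem_nhdsWithin_of_mem_nhds hV, K, hK⟩

end Convex

/-! ### Projections -/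

theorem IsProjection.inner_le_zero {n : ℕ} {S : Set (E n)} (hS : Convex ℝ S) {x p : E n}
    (hp : IsProjection S x p) {z : E n} (hz : z ∈ S) : inner ℝ (x - p) (z - p) ≤ 0 := by
  have : Nonempty S := ⟨⟨p, hp.1⟩⟩
  refine (norm_eq_iInf_iff_real_inner_le_zero hS hp.1).1 (le_antisymm ?_ ?_) z hz
  · exact le_ciInf fun w => hp.2 w w.2
  · exact ciInf_le ⟨0, by rintro _ ⟨w, rfl⟩; positivity⟩ (⟨p, hp.1⟩ : S)

theorem IsProjection.norm_sub_sq_le {n : ℕ} {S : Set (E n)} (hS : Convex ℝ S) {x p : E n}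
    (hp : IsProjection S x p) {z : E n} (hz : z ∈ S) : ‖p - z‖ ^ 2 ≤ ‖x - z‖ ^ 2 := by
  have h1 := hp.inner_le_zero hS hz
  have h2 : x - z = (x - p) - (z - p) := by abel
  have h3 := norm_sub_sq_real (x - p) (z - p)
  rw [← h2] at h3
  rw [norm_sub_rev p z]
  nlinarith [sq_nonneg ‖x - p‖]

section NonnegPart

variable {m : ℕ}

@[simp] theorem nonnegPart_apply (z : E m) (k : Fin m) : nonnegPart z k = max (z k) 0 := rfl

theorem norm_nonnegPart_sub_le (u v : E m) : ‖nonnegPart u - nonnegPart v‖ ≤ ‖u - v‖ := by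
  rw [EuclideanSpace.norm_eq, EuclideanSpace.norm_eq]
  refine Real.sqrt_le_sqrt (Finset.sum_le_sum fun k _ => ?_)
  simp only [PiLp.sub_apply, nonnegPart_apply, Real.norm_eq_abs]
  exact pow_le_pow_left₀ (abs_nonneg _) (abs_max_sub_max_le_abs _ _ _) 2

theorem nonnegPart_of_nonneg {u : E m} (hu : ∀ k, 0 ≤ u k) : nonnegPart u = u := by
  ext k
  simp [hu k]

theorem norm_nonnegPart_le (u : E m) : ‖nonnegPart u‖ ≤ ‖u‖ := by
  have h := norm_nonnegPart_sub_le u 0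
  rwa [nonnegPart_of_nonneg (u := 0) (by simp), sub_zero, sub_zero] at h

theorem inner_nonnegPart_self (u : E m) : inner ℝ (nonnegPart u) u = ‖nonnegPart u‖ ^ 2 := by
  rw [← real_inner_self_eq_norm_sq]
  simp only [PiLp.inner_apply]
  refine Finset.sum_congr rfl fun k _ => ?_
  simp only [nonnegPart_apply, RCLike.inner_apply, conj_trivial]
  rcases le_total (u k) 0 with h | h <;> simp [h]

end NonnegPart

open Finset

/-! ### Doubly stochastic mixing -/

namespace Network

variable {N : ℕ} {G : Network N}

theorem weight_nonneg (G : Network N) (t : ℕ) (i j : Fin N) : 0 ≤ G.A t i j := by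
  by_cases h : G.edge t j i
  · exact (G.weight_pos t i j h).le
  · exact (G.weight_zero t i j h).ge

/-- Unit column sums and row sums at most one force unit row sums. -/
theorem Admissible.row_sum_eq_one (hG : G.Admissible) (t : ℕ) (i : Fin N) :
    ∑ j, G.A t i j = 1 := by
  have h1 : ∑ i, ∑ j, G.A t i j = ∑ _i : Fin N, (1 : ℝ) :=
    Finset.sum_comm.trans (Finset.sum_congr rfl fun j _ => hG.col_sum t j)
  exact (Finset.sum_eq_sum_iff_of_le fun i _ => hG.row_sum t i).1 h1 i (Finset.mem_univ i)

variable {m : ℕ}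

theorem norm_mix_le (hG : G.Admissible) (t : ℕ) {z : Fin N → E m} {R : ℝ}
    (hz : ∀ j, ‖z j‖ ≤ R) (i : Fin N) : ‖G.mix t z i‖ ≤ R := by
  calc ‖G.mix t z i‖ ≤ ∑ j, ‖G.A t i j • z j‖ := norm_sum_le _ _
    _ ≤ ∑ j, G.A t i j * R := by
        refine Finset.sum_le_sum fun j _ => ?_
        rw [norm_smul, Real.norm_of_nonneg (G.weight_nonneg t i j)]
        exact mul_le_mul_of_nonneg_left (hz j) (G.weight_nonneg t i j)
    _ = R := by rw [← Finset.sum_mul, hG.row_sum_eq_one, one_mul]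

theorem sum_mix (hG : G.Admissible) (t : ℕ) (z : Fin N → E m) :
    ∑ i, G.mix t z i = ∑ i, z i := by
  simp only [mix]
  rw [Finset.sum_comm]
  refine Finset.sum_congr rfl fun j _ => ?_
  rw [← Finset.sum_smul, hG.col_sum, one_smul]

theorem mix_sub_const (hG : G.Admissible) (t : ℕ) (z : Fin N → E m) (c : E m) (i : Fin N) :
    G.mix t (fun j => z j - c) i = G.mix t z i - c := by
  simp only [mix, smul_sub, Finset.sum_sub_distrib, ← Finset.sum_smul, hG.row_sum_eq_one, one_smul]

theorem mix_sub (t : ℕ) (z z' : Fin N → E m) (i : Fin N) :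
    G.mix t (fun j => z j - z' j) i = G.mix t z i - G.mix t z' i := by
  simp only [mix, smul_sub, Finset.sum_sub_distrib]

/-- Jensen's inequality along the rows, then the unit column sums. -/
theorem sum_norm_mix_sub_sq_le (hG : G.Admissible) (t : ℕ) (z : Fin N → E m) (c : E m) :
    ∑ i, ‖G.mix t z i - c‖ ^ 2 ≤ ∑ i, ‖z i - c‖ ^ 2 := by
  have hconv : ConvexOn ℝ Set.univ (fun v : E m => ‖v‖ ^ 2) :=
    (convexOn_univ_norm).pow (fun _ _ => norm_nonneg _) 2
  have h1 : ∀ i, ‖G.mix t z i - c‖ ^ 2 ≤ ∑ j, G.A t i j * ‖z j - c‖ ^ 2 := by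
    intro i
    rw [← mix_sub_const hG]
    exact hconv.map_sum_le (t := Finset.univ) (w := G.A t i) (p := fun j => z j - c)
      (fun j _ => G.weight_nonneg t i j) (hG.row_sum_eq_one t i) (fun _ _ => Set.mem_univ _)
  refine (Finset.sum_le_sum fun i _ => h1 i).trans_eq ?_
  rw [Finset.sum_comm]
  refine Finset.sum_congr rfl fun j _ => ?_
  rw [← Finset.sum_mul, hG.col_sum, one_mul]

theorem mix_apply_nonneg (t : ℕ) {z : Fin N → E m} (hz : ∀ j k, 0 ≤ z j k) (i : Fin N)
    (k : Fin m) : 0 ≤ G.mix t z i k := by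
  simp only [mix, WithLp.ofLp_sum, PiLp.smul_apply, Finset.sum_apply, smul_eq_mul]
  exact Finset.sum_nonneg fun j _ => mul_nonneg (G.weight_nonneg t i j) (hz j k)

/-! ### Products of weight matrices -/

/-- The transition matrix `A_{s+k-1} ⋯ A_s`. -/
def transition (G : Network N) (s : ℕ) : ℕ → Matrix (Fin N) (Fin N) ℝ
  | 0 => 1
  | k + 1 => G.A (s + k) * G.transition s k

theorem transition_nonneg (G : Network N) (s k : ℕ) (i j : Fin N) : 0 ≤ G.transition s k i j := by
  induction k generalizing i with
  | zero =>
    simp only [transition, Matrix.one_apply]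
    split_ifs <;> norm_num
  | succ k ih =>
    simp only [transition, Matrix.mul_apply]
    exact Finset.sum_nonneg fun l _ => mul_nonneg (G.weight_nonneg _ _ _) (ih l)

theorem Admissible.transition_row_sum (hG : G.Admissible) (s k : ℕ) (i : Fin N) :
    ∑ j, G.transition s k i j = 1 := by
  induction k generalizing i with
  | zero => simp [transition, Matrix.one_apply]
  | succ k ih =>
    simp only [transition, Matrix.mul_apply]
    rw [Finset.sum_comm]
    simp only [← Finset.mul_sum, ih, mul_one, hG.row_sum_eq_one]

section LowerBound

variable {a : ℝ} (ha : ∀ t i j, 0 < G.A t i j → a ≤ G.A t i j) (ha0 : 0 < a)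
include ha ha0

theorem transition_step {s k : ℕ} {u v j : Fin N} (he : G.edge (s + k) u v)
    (hu : a ^ k ≤ G.transition s k u j) : a ^ (k + 1) ≤ G.transition s (k + 1) v j := by
  simp only [transition, Matrix.mul_apply]
  calc a ^ (k + 1) = a * a ^ k := by ring
    _ ≤ G.A (s + k) v u * G.transition s k u j :=
        mul_le_mul (ha _ _ _ (G.weight_pos _ _ _ he)) hu (by positivity) (G.weight_nonneg _ _ _)
    _ ≤ _ := Finset.single_le_sum (f := fun l => G.A (s + k) v l * G.transition s k l j)
        (fun l _ => mul_nonneg (G.weight_nonneg _ _ _) (G.transition_nonneg _ _ _ _))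
        (Finset.mem_univ u)

theorem transition_stay {s k : ℕ} {u j : Fin N} (hu : a ^ k ≤ G.transition s k u j) (l : ℕ) :
    a ^ (k + l) ≤ G.transition s (k + l) u j := by
  induction l with
  | zero => exact hu
  | succ l ih => exact transition_step ha ha0 (G.self_loop _ _) ih

open Classical in
-- Self-loops keep an agent that has received weight from `j` above the threshold, and in each
-- window of length `Q` strong connectivity adds a new agent until all are reached.
theorem transition_reach {Q : ℕ} (hQ : ∀ t, 1 ≤ t → ∀ i j,
    Relation.ReflTransGen (fun u v => ∃ l, l < Q ∧ G.edge (t + l) u v) i j)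
    {s : ℕ} (hs : 1 ≤ s) (j : Fin N) (k : ℕ) :
    min (k + 1) N ≤ #{i | a ^ (k * Q) ≤ G.transition s (k * Q) i j} := by
  induction k with
  | zero =>
    refine (min_le_left _ _).trans (Finset.card_pos.2 ⟨j, ?_⟩)
    simp [transition]
  | succ k ih =>
    set S : Finset (Fin N) := {i | a ^ (k * Q) ≤ G.transition s (k * Q) i j} with hS
    set S' : Finset (Fin N) := {i | a ^ ((k + 1) * Q) ≤ G.transition s ((k + 1) * Q) i j} with hS'
    have hsub : S ⊆ S' := by
      intro i hi
      rw [hS, Finset.mem_filter] at hi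
      rw [hS', Finset.mem_filter, Nat.succ_mul]
      exact ⟨Finset.mem_univ _, transition_stay ha ha0 hi.2 Q⟩
    by_cases hall : S = Finset.univ
    · have : S' = Finset.univ := Finset.eq_univ_of_forall fun i => hsub (hall ▸ Finset.mem_univ i)
      rw [this, Finset.card_univ, Fintype.card_fin]
      exact min_le_right _ _
    · obtain ⟨v, hv⟩ : ∃ v, v ∉ S := by
        by_contra! h
        exact hall (Finset.eq_univ_of_forall h)
      have hcard : 0 < #S := by
        have hN : 0 < N := v.pos
        omega
      obtain ⟨u, hu⟩ := Finset.card_pos.1 hcard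
      -- If no edge of the window left `S`, every agent reachable from `u` would lie in `S`,
      -- including `v`.
      obtain ⟨p, q, hp, hq, l, hl, he⟩ : ∃ p q, p ∈ S ∧ q ∉ S ∧
          ∃ l, l < Q ∧ G.edge (s + k * Q + l) p q := by
        by_contra! h
        have : ∀ w, Relation.ReflTransGen
            (fun u v => ∃ l, l < Q ∧ G.edge (s + k * Q + l) u v) u w → w ∈ S := by
          intro w hw
          induction hw with
          | refl => exact hu
          | tail _ h2 ih2 =>
            obtain ⟨l, hl, he⟩ := h2
            by_contra h3
            exact h _ _ ih2 h3 l hl he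
        exact hv (this v (hQ (s + k * Q) (by omega) u v))
      have hq' : q ∈ S' := by
        rw [hS', Finset.mem_filter]
        refine ⟨Finset.mem_univ _, ?_⟩
        rw [hS, Finset.mem_filter] at hp
        have h1 := transition_stay ha ha0 hp.2 l
        rw [add_assoc] at he
        -- The edge is used in round `l` of the window; the remaining `Q - l - 1` rounds are spent
        -- on self-loops.
        have h2 := transition_stay ha ha0 (transition_step ha ha0 he h1) (Q - l - 1)
        have h3 : k * Q + l + 1 + (Q - l - 1) = (k + 1) * Q := by
          rw [Nat.succ_mul]; omega
        rwa [h3] at h2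
      have : #S < #S' := Finset.card_lt_card
        ((Finset.ssubset_iff_of_subset hsub).2 ⟨q, hq', hq⟩)
      omega

theorem transition_lower_bound {Q : ℕ} (hQ : ∀ t, 1 ≤ t → ∀ i j,
    Relation.ReflTransGen (fun u v => ∃ l, l < Q ∧ G.edge (t + l) u v) i j)
    {s : ℕ} (hs : 1 ≤ s) (i j : Fin N) :
    a ^ (N * Q) ≤ G.transition s (N * Q) i j := by
  classical
  have h := transition_reach ha ha0 hQ hs j N
  rw [min_eq_right (Nat.le_succ N)] at h
  have h2 : ({i | a ^ (N * Q) ≤ G.transition s (N * Q) i j} : Finset (Fin N)) = Finset.univ := by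
    rw [← Finset.card_eq_iff_eq_univ, Fintype.card_fin]
    exact le_antisymm ((Finset.card_le_univ _).trans_eq (Fintype.card_fin N)) h
  have h3 := Finset.mem_univ i
  rw [← h2, Finset.mem_filter] at h3
  exact h3.2

end LowerBound

/-- Over windows of a fixed length the transition matrices have uniformly positive entries. -/
theorem Admissible.exists_transition_lower_bound (hG : G.Admissible) :
    ∃ (B : ℕ) (c : ℝ), 0 < B ∧ 0 < c ∧ c ≤ 1 ∧
      ∀ s, 1 ≤ s → ∀ i j, c ≤ G.transition s B i j := by
  rcases Nat.eq_zero_or_pos N with h0 | h0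
  · subst h0
    exact ⟨1, 1, one_pos, one_pos, le_rfl, fun _ _ i => i.elim0⟩
  obtain ⟨a, ha0, ha1, ha⟩ := hG.lower_bound
  obtain ⟨Q, hQ0, hQ⟩ := hG.connected
  exact ⟨N * Q, a ^ (N * Q), Nat.mul_pos h0 hQ0, by positivity, pow_le_one₀ ha0.le ha1.le,
    fun s hs i j => transition_lower_bound ha ha0 hQ hs i j⟩

/-! ### Perturbed consensus -/

/-- Mixing does not increase the maximal norm, so the perturbations accumulate at most additively.
-/
theorem norm_sub_transition_le (hG : G.Admissible) {e : ℕ → Fin N → E m} {s k : ℕ} {δ : ℝ}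
    (he : ∀ l, l < k → ∀ i, ‖e (s + l + 1) i - G.mix (s + l) (e (s + l)) i‖ ≤ δ) (i : Fin N) :
    ‖e (s + k) i - ∑ j, G.transition s k i j • e s j‖ ≤ k * δ := by
  induction k generalizing i with
  | zero => simp [transition, Matrix.one_apply]
  | succ k ih =>
    have h1 := he k (Nat.lt_succ_self k) i
    have h2 := norm_mix_le hG (s + k) (z := fun i => e (s + k) i -
      ∑ j, G.transition s k i j • e s j) (ih fun l hl => he l (hl.trans (Nat.lt_succ_self k))) i
    rw [mix_sub] at h2
    have h3 : G.mix (s + k) (fun i => ∑ j, G.transition s k i j • e s j) i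
        = ∑ j, G.transition s (k + 1) i j • e s j := by
      simp only [mix, transition, Matrix.mul_apply, Finset.smul_sum, Finset.sum_smul, smul_smul]
      exact Finset.sum_comm
    rw [h3] at h2
    have h4 := norm_add_le (e (s + k + 1) i - G.mix (s + k) (e (s + k)) i)
      (G.mix (s + k) (e (s + k)) i - ∑ j, G.transition s (k + 1) i j • e s j)
    rw [sub_add_sub_cancel] at h4
    push_cast
    rw [← add_assoc]
    linarith

/-- On a zero-sum family, subtracting `c` from every weight changes nothing; the remaining
nonnegative weights sum to `1 - N c ≤ 1 - c`. -/
theorem norm_transition_apply_le (hG : G.Admissible) {s k : ℕ} {c : ℝ} (hc0 : 0 ≤ c)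
    (hc : ∀ i j, c ≤ G.transition s k i j) {e : Fin N → E m} (he : ∑ j, e j = 0) {R : ℝ}
    (hR : ∀ j, ‖e j‖ ≤ R) (i : Fin N) :
    ‖∑ j, G.transition s k i j • e j‖ ≤ (1 - c) * R := by
  have h1 : ∑ j, G.transition s k i j • e j = ∑ j, (G.transition s k i j - c) • e j := by
    simp only [sub_smul, Finset.sum_sub_distrib, ← Finset.smul_sum, he, smul_zero, sub_zero]
  have hR0 : 0 ≤ R := (norm_nonneg _).trans (hR i)
  have hN : (1 : ℝ) ≤ N := by exact_mod_cast i.pos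
  calc ‖∑ j, G.transition s k i j • e j‖ ≤ ∑ j, ‖(G.transition s k i j - c) • e j‖ := by
        rw [h1]; exact norm_sum_le _ _
    _ ≤ ∑ j, (G.transition s k i j - c) * R := by
        refine Finset.sum_le_sum fun j _ => ?_
        rw [norm_smul, Real.norm_of_nonneg (sub_nonneg.2 (hc i j))]
        exact mul_le_mul_of_nonneg_left (hR j) (sub_nonneg.2 (hc i j))
    _ = (1 - N * c) * R := by
        rw [← Finset.sum_mul, Finset.sum_sub_distrib, hG.transition_row_sum]
        simp
    _ ≤ (1 - c) * R := mul_le_mul_of_nonneg_right (by nlinarith) hR0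

/-- The mean of the agents' vectors. -/
noncomputable def avg (z : Fin N → E m) : E m := (N : ℝ)⁻¹ • ∑ i, z i

theorem norm_avg_le {z : Fin N → E m} {R : ℝ} (hR0 : 0 ≤ R) (hR : ∀ i, ‖z i‖ ≤ R) :
    ‖avg z‖ ≤ R := by
  rw [avg, norm_smul, norm_inv, Real.norm_natCast]
  have h : ‖∑ i, z i‖ ≤ N * R := by
    calc ‖∑ i, z i‖ ≤ ∑ i, ‖z i‖ := norm_sum_le _ _
      _ ≤ ∑ _i : Fin N, R := Finset.sum_le_sum fun i _ => hR i
      _ = N * R := by simp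
  rcases Nat.eq_zero_or_pos N with h0 | h0
  · simp [h0, hR0]
  · have : (0 : ℝ) < N := by exact_mod_cast h0
    rw [inv_mul_le_iff₀ this]
    exact h

theorem sum_sub_avg (z : Fin N → E m) : ∑ i, (z i - avg z) = 0 := by
  rcases Nat.eq_zero_or_pos N with h0 | h0
  · subst h0; simp
  · have : (N : ℝ) ≠ 0 := by exact_mod_cast h0.ne'
    rw [Finset.sum_sub_distrib, avg, Finset.sum_const, Finset.card_univ, Fintype.card_fin,
      ← Nat.cast_smul_eq_nsmul ℝ, smul_smul, mul_inv_cancel₀ this, one_smul, sub_self]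

/-- A perturbed averaging process whose perturbations are of the order of a slowly varying
sequence `h` has disagreement of the order of `h`, uniformly over all horizons. -/
theorem Admissible.exists_disagreement_bound (hG : G.Admissible) {h : ℕ → ℝ}
    (hpos : ∀ t, 0 < h t) (hanti : Antitone h)
    (hslow : ∀ θ < 1, ∀ B : ℕ, ∃ t₀, ∀ t, t₀ ≤ t → θ * h t ≤ h (t + B)) {r η : ℝ}
    (hη : 0 ≤ η) (hr : 0 ≤ r) :
    ∃ K, 0 ≤ K ∧ ∀ (T : ℕ) (z : ℕ → Fin N → E m), (∀ i, ‖z 0 i‖ ≤ r) →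
      (∀ t, t < T → ∀ i, ‖z (t + 1) i - G.mix t (z t) i‖ ≤ η * h t) →
      ∀ t, t ≤ T → ∀ i, ‖z t i - avg (z t)‖ ≤ K * h t := by
  obtain ⟨B, c, hB, hc0, hc1, hc⟩ := hG.exists_transition_lower_bound
  obtain ⟨t₀, ht₀⟩ := hslow (1 - c / 2) (by linarith) B
  set M := t₀ + B + 1 with hM
  -- The first entry covers `t ≤ M`, where the crude linear growth `hinit` suffices. The second
  -- closes the induction over windows: `(1 - c) K + 2 B η ≤ (1 - c/2) K`, and `(1 - c/2) h s ≤ h (s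
  -- + B)` by slow variation. The size of `M` ensures that windows start after `t₀` and no earlier
  -- than time 1, from which connectivity holds.
  set K := max ((2 * r + 2 * η * h 0 * M) / h M) (4 * B * η / c) with hK
  have hK1 : 2 * r + 2 * η * h 0 * M ≤ K * h M := by
    rw [← div_le_iff₀ (hpos M)]
    exact le_max_left _ _
  have hK2 : 4 * B * η ≤ K * c := by
    rw [← div_le_iff₀ hc0]
    exact le_max_right _ _
  have hK0 : 0 ≤ K := le_trans (by positivity) (le_max_right _ _)
  refine ⟨K, hK0, fun T z hz0 hz => ?_⟩
  -- Deviations from the mean obey the same recursion; the motion of the mean at most doubles the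
  -- perturbation.
  have hstep : ∀ t, t < T → ∀ i, ‖(z (t + 1) i - avg (z (t + 1)))
      - G.mix t (fun j => z t j - avg (z t)) i‖ ≤ 2 * η * h t := by
    intro t ht i
    have h1 : avg (z (t + 1)) - avg (z t) = avg (fun i => z (t + 1) i - G.mix t (z t) i) := by
      simp only [avg, Finset.sum_sub_distrib, sum_mix hG, smul_sub]
    have h2 : ‖avg (z (t + 1)) - avg (z t)‖ ≤ η * h t := by
      rw [h1]
      exact norm_avg_le (mul_nonneg hη (hpos t).le) (hz t ht)
    rw [mix_sub_const hG]
    calc _ = ‖(z (t + 1) i - G.mix t (z t) i) - (avg (z (t + 1)) - avg (z t))‖ := by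
          congr 1; abel
      _ ≤ η * h t + η * h t := (norm_sub_le _ _).trans (add_le_add (hz t ht i) h2)
      _ = _ := by ring
  have hinit : ∀ t, t ≤ T → ∀ i, ‖z t i - avg (z t)‖ ≤ 2 * r + 2 * η * h 0 * t := by
    intro t
    induction t with
    | zero =>
      intro _ i
      have := (norm_sub_le _ _).trans (add_le_add (hz0 i) (norm_avg_le hr hz0))
      simpa [two_mul] using this
    | succ t ih =>
      intro ht i
      have h1 := hstep t ht i
      have h2 := norm_mix_le hG t (ih (by omega)) i
      have h3 := norm_add_le ((z (t + 1) i - avg (z (t + 1)))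
        - G.mix t (fun j => z t j - avg (z t)) i) (G.mix t (fun j => z t j - avg (z t)) i)
      rw [sub_add_cancel] at h3
      have h4 : 2 * η * h t ≤ 2 * η * h 0 :=
        mul_le_mul_of_nonneg_left (hanti (Nat.zero_le t)) (by positivity)
      push_cast
      linarith
  intro t
  induction t using Nat.strong_induction_on with
  | _ t ih =>
    intro ht i
    rcases le_or_gt t M with htM | htM
    · have h1 : 2 * η * h 0 * (t : ℝ) ≤ 2 * η * h 0 * M :=
        mul_le_mul_of_nonneg_left (by exact_mod_cast htM)
          (mul_nonneg (by positivity) (hpos 0).le)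
      have h2 : K * h M ≤ K * h t := mul_le_mul_of_nonneg_left (hanti htM) hK0
      linarith [hinit t ht i]
    · obtain ⟨s, rfl⟩ : ∃ s, t = s + B := ⟨t - B, by omega⟩
      have h1 := norm_sub_transition_le hG (e := fun t i => z t i - avg (z t)) (s := s) (k := B)
        (δ := 2 * η * h s) (fun l hl i => (hstep (s + l) (by omega) i).trans
          (mul_le_mul_of_nonneg_left (hanti (Nat.le_add_right s l)) (by positivity))) i
      have h2 := norm_transition_apply_le hG hc0.le (hc s (by omega)) (sum_sub_avg (z s))
        (ih s (by omega) (by omega)) i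
      have h3 := norm_add_le (z (s + B) i - avg (z (s + B)) -
        ∑ j, G.transition s B i j • (z s j - avg (z s)))
        (∑ j, G.transition s B i j • (z s j - avg (z s)))
      rw [sub_add_cancel] at h3
      have h4 := mul_le_mul_of_nonneg_left (ht₀ s (by omega)) hK0
      have h5 := mul_le_mul_of_nonneg_right hK2 (hpos s).le
      nlinarith

end Network

/-! ### Stepsizes -/

theorem alpha_pos (t : ℕ) : 0 < alpha t := by
  unfold alpha
  split_ifs with h
  · exact one_pos
  · have : (0 : ℝ) < t := by exact_mod_cast Nat.pos_of_ne_zero h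
    positivity

theorem alpha_of_pos {t : ℕ} (ht : 1 ≤ t) : alpha t = 1 / Real.sqrt t := by
  rw [alpha, if_neg (by omega)]

theorem sqrt_mul_alpha {t : ℕ} (ht : 1 ≤ t) : Real.sqrt t * alpha t = 1 := by
  have : (0 : ℝ) < t := by exact_mod_cast ht
  rw [alpha_of_pos ht, mul_one_div_cancel (Real.sqrt_pos.2 this).ne']

theorem alpha_antitone : Antitone alpha := by
  refine antitone_nat_of_succ_le fun t => ?_
  rcases Nat.eq_zero_or_pos t with rfl | h
  · simp [alpha]
  · have : (0 : ℝ) < t := by exact_mod_cast h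
    rw [alpha_of_pos h, alpha_of_pos (by omega)]
    exact one_div_le_one_div_of_le (Real.sqrt_pos.2 this)
      (Real.sqrt_le_sqrt (by push_cast; linarith))

theorem alpha_le_one (t : ℕ) : alpha t ≤ 1 :=
  (alpha_antitone (Nat.zero_le t)).trans_eq (by simp [alpha])

theorem alpha_slow (θ : ℝ) (hθ : θ < 1) (B : ℕ) :
    ∃ t₀, ∀ t, t₀ ≤ t → θ * alpha t ≤ alpha (t + B) := by
  rcases le_or_gt θ 0 with h0 | h0
  · exact ⟨0, fun t _ => (mul_nonpos_of_nonpos_of_nonneg h0 (alpha_pos t).le).trans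
      (alpha_pos _).le⟩
  obtain ⟨t₀, ht₀⟩ := exists_nat_ge (B / (1 - θ))
  refine ⟨t₀ + 1, fun t ht => ?_⟩
  have ht1 : (0 : ℝ) < t := by exact_mod_cast (by omega : 0 < t)
  have h1 : (B : ℝ) ≤ t * (1 - θ) := by
    rw [← div_le_iff₀ (by linarith)]
    exact ht₀.trans (by exact_mod_cast (by omega : t₀ ≤ t))
  rw [alpha_of_pos (by omega), alpha_of_pos (by omega), mul_one_div,
    div_le_div_iff₀ (Real.sqrt_pos.2 ht1)
      (Real.sqrt_pos.2 (by push_cast; positivity)), one_mul]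
  refine Real.le_sqrt_of_sq_le ?_
  rw [mul_pow, Real.sq_sqrt (Nat.cast_nonneg _)]
  push_cast
  -- As `θ < 1`, this also gives `θ² (t + B) ≤ t`, the squared form of the goal.
  have h2 : θ * (t + B : ℝ) ≤ t := by nlinarith
  nlinarith

/-- The increment is `1 / (√(n+1) + √n)`. It controls the growth of the weights in the summation by
parts. -/
theorem sqrt_sub_sqrt_le_alpha (n : ℕ) :
    Real.sqrt (n + 1 : ℕ) ≤ Real.sqrt n + alpha (n + 1) := by
  have h1 := sqrt_mul_alpha (t := n + 1) (by omega)
  have h2 := alpha_pos (n + 1)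
  have h3 := Real.sq_sqrt (Nat.cast_nonneg (α := ℝ) n)
  have h4 := Real.sq_sqrt (Nat.cast_nonneg (α := ℝ) (n + 1))
  have h5 := Real.sqrt_nonneg (n : ℝ)
  have h6 := Real.sqrt_nonneg ((n + 1 : ℕ) : ℝ)
  have h7 : ((n + 1 : ℕ) : ℝ) = n + 1 := by push_cast; ring
  have h8 : Real.sqrt n ≤ Real.sqrt (n + 1 : ℕ) := Real.sqrt_le_sqrt (by rw [h7]; linarith)
  have h9 : 0 < Real.sqrt (n + 1 : ℕ) := by
    rcases h6.eq_or_lt with h | h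
    · rw [← h] at h1; simp at h1
    · exact h
  refine le_of_mul_le_mul_left ?_ h9
  nlinarith

section Beta

variable {κ : ℝ}

theorem beta_pos (t : ℕ) : 0 < beta κ t := by
  unfold beta
  split_ifs with h
  · exact one_pos
  · have : (0 : ℝ) < t := by exact_mod_cast Nat.pos_of_ne_zero h
    positivity

theorem beta_of_pos {t : ℕ} (ht : 1 ≤ t) : beta κ t = (t : ℝ) ^ (-κ) := by
  rw [beta, if_neg (by omega), Real.rpow_neg (Nat.cast_nonneg _), one_div]

theorem beta_antitone (hκ : 0 ≤ κ) : Antitone (beta κ) := by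
  refine antitone_nat_of_succ_le fun t => ?_
  rcases Nat.eq_zero_or_pos t with rfl | h
  · simp [beta]
  · have : (0 : ℝ) < t := by exact_mod_cast h
    rw [beta_of_pos h, beta_of_pos (by omega)]
    exact Real.rpow_le_rpow_of_nonpos this (by push_cast; linarith) (by linarith)

theorem beta_le_one (hκ : 0 ≤ κ) (t : ℕ) : beta κ t ≤ 1 :=
  (beta_antitone hκ (Nat.zero_le t)).trans_eq (by simp [beta])

theorem alpha_le_beta (h1 : κ ≤ 1 / 2) (t : ℕ) : alpha t ≤ beta κ t := by
  rcases Nat.eq_zero_or_pos t with rfl | h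
  · simp [alpha, beta]
  · rw [alpha_of_pos h, beta_of_pos h, Real.sqrt_eq_rpow, one_div,
      ← Real.rpow_neg (Nat.cast_nonneg _)]
    exact Real.rpow_le_rpow_of_exponent_le (by exact_mod_cast h) (by linarith)

theorem alpha_div_beta_sq {t : ℕ} (h : 1 ≤ t) :
    alpha t / beta κ t ^ 2 = (t : ℝ) ^ ((1 / 2 + 2 * κ) - 1) := by
  have ht : (0 : ℝ) < t := by exact_mod_cast h
  rw [alpha_of_pos h, beta_of_pos h, Real.sqrt_eq_rpow, one_div,
    ← Real.rpow_neg ht.le, ← Real.rpow_natCast, ← Real.rpow_mul ht.le, ← Real.rpow_sub ht]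
  congr 1
  push_cast
  ring

end Beta

/-! ### Summation -/

theorem sum_rpow_sub_one_le {p : ℝ} (hp0 : 0 < p) (hp1 : p ≤ 1) (n : ℕ) :
    p * ∑ t ∈ Icc 1 n, (t : ℝ) ^ (p - 1) ≤ (n : ℝ) ^ p := by
  induction n with
  | zero => simp [Real.zero_rpow hp0.ne']
  | succ n ih =>
    rw [Finset.sum_Icc_succ_top (by omega), mul_add]
    have hn : (0 : ℝ) < (n + 1 : ℕ) := by positivity
    -- Bernoulli's inequality for exponents at most one, at `-1/(n+1)`: after scaling, `n^p + p
    -- (n+1)^(p-1) ≤ (n+1)^p`, which telescopes.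
    have h1 := rpow_one_add_le_one_add_mul_self (s := -(1 / ((n + 1 : ℕ) : ℝ))) (p := p)
      (neg_le_neg ((div_le_one hn).2 (by push_cast; linarith [(Nat.cast_nonneg n : (0 : ℝ) ≤ n)])))
      hp0.le hp1
    have h2 : (1 + -(1 / ((n + 1 : ℕ) : ℝ))) = n / (n + 1 : ℕ) := by
      field_simp
      push_cast
      ring
    rw [h2, Real.div_rpow (Nat.cast_nonneg _) hn.le, div_le_iff₀ (by positivity)] at h1
    have h3 : ((n + 1 : ℕ) : ℝ) ^ (p - 1) = ((n + 1 : ℕ) : ℝ) ^ p * (1 / ((n + 1 : ℕ) : ℝ)) := by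
      rw [Real.rpow_sub_one hn.ne', mul_one_div]
    rw [h3]
    nlinarith

/-- Summation by parts for a descent inequality with stepsizes `alpha`. -/
theorem sum_le_of_descent {n : ℕ} {W Φ R w : ℕ → ℝ} (hW : ∀ t, 0 ≤ W t)
    (hw : ∀ t, 1 ≤ t → t ≤ n → W t ≤ w t)
    (h : ∀ t, 1 ≤ t → t ≤ n → 2 * alpha t * Φ t ≤ W t - W (t + 1) + 2 * alpha t * R t) :
    ∑ t ∈ Icc 1 n, Φ t ≤ ∑ t ∈ Icc 1 n, (alpha t * w t / 2 + R t) := by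
  -- Step `t` is multiplied by `√t = 1/α_t`. The term `√k/2 * W (k + 1)` is carried along so that
  -- each `W t` is left with the coefficient `(√t - √(t-1))/2 ≤ α_t/2`.
  suffices H : ∀ k ≤ n, ∑ t ∈ Icc 1 k, Φ t + Real.sqrt k / 2 * W (k + 1)
      ≤ ∑ t ∈ Icc 1 k, (alpha t * w t / 2 + R t) by
    have h1 := H n le_rfl
    have h2 : 0 ≤ Real.sqrt n / 2 * W (n + 1) := mul_nonneg (by positivity) (hW _)
    linarith
  intro k
  induction k with
  | zero => simp
  | succ k ih =>
    intro hk
    have h0 := ih (by omega)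
    rw [Finset.sum_Icc_succ_top (by omega), Finset.sum_Icc_succ_top (by omega)]
    have h1 := mul_le_mul_of_nonneg_left (h (k + 1) (by omega) hk)
      (Real.sqrt_nonneg ((k + 1 : ℕ) : ℝ))
    have h2 := sqrt_mul_alpha (t := k + 1) (by omega)
    have h3 : Real.sqrt (k + 1 : ℕ) * (2 * alpha (k + 1) * Φ (k + 1)) = 2 * Φ (k + 1) := by
      linear_combination 2 * Φ (k + 1) * h2
    have h4 : Real.sqrt (k + 1 : ℕ) * (W (k + 1) - W (k + 1 + 1) + 2 * alpha (k + 1) * R (k + 1))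
        = Real.sqrt (k + 1 : ℕ) * W (k + 1) - Real.sqrt (k + 1 : ℕ) * W (k + 1 + 1)
          + 2 * R (k + 1) := by
      linear_combination 2 * R (k + 1) * h2
    rw [h3, h4] at h1
    have h5 := mul_le_mul_of_nonneg_right (sqrt_sub_sqrt_le_alpha k) (hW (k + 1))
    have h6 := mul_le_mul_of_nonneg_left (hw (k + 1) (by omega) hk) (alpha_pos (k + 1)).le
    linarith

variable {N m : ℕ}

/-! ### Compactness: continuity, uniform bounds and existence of minimizers. -/

namespace Problem

variable {P : Problem N m}

@[simp] theorem gval_apply (i : Fin N) (x : E (P.n i)) (k : Fin m) :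
    P.gval i x k = (P.g i x k).toReal := rfl

namespace Admissible

theorem g_domain (hP : P.Admissible) (i : Fin N) (k : Fin m) :
    P.X i ⊆ interior {x | P.g i x k < ⊤} :=
  (hP.domain_g i).trans (interior_mono fun _ hx => hx k)

theorem f_lt_top (hP : P.Admissible) (i : Fin N) (t : ℕ) {x : E (P.n i)} (hx : x ∈ P.X i) :
    P.f i t x < ⊤ := by
  have h : interior {x | P.f i t x < ⊤} ⊆ {x | P.f i t x < ⊤} := interior_subset
  exact h (hP.domain_f i t hx)

theorem g_lt_top (hP : P.Admissible) (i : Fin N) (k : Fin m) {x : E (P.n i)} (hx : x ∈ P.X i) :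
    P.g i x k < ⊤ := by
  have h : interior {x | P.g i x k < ⊤} ⊆ {x | P.g i x k < ⊤} := interior_subset
  exact h (hP.g_domain i k hx)

theorem continuousOn_fval (hP : P.Admissible) (i : Fin N) (t : ℕ) :
    ContinuousOn (P.fval i t) (P.X i) :=
  (hP.proper_f i t).continuousOn_toReal (hP.convex_f i t) (hP.domain_f i t)

theorem continuousOn_gval (hP : P.Admissible) (i : Fin N) : ContinuousOn (P.gval i) (P.X i) := by
  refine (PiLp.continuous_toLp 2 _).comp_continuousOn (continuousOn_pi.2 fun k => ?_)
  exact (hP.proper_g i k).continuousOn_toReal (hP.convex_g i k) (hP.g_domain i k)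

theorem exists_gval_bound (hP : P.Admissible) :
    ∃ b, 0 ≤ b ∧ ∀ i, ∀ x ∈ P.X i, ‖P.gval i x‖ ≤ b := by
  choose b hb using fun i => (hP.compact_X i).exists_bound_of_continuousOn (hP.continuousOn_gval i)
  refine ⟨∑ i, |b i|, by positivity, fun i x hx => (hb i x hx).trans ((le_abs_self _).trans ?_)⟩
  exact Finset.single_le_sum (f := fun i => |b i|) (fun _ _ => abs_nonneg _) (Finset.mem_univ i)

theorem exists_subgradient_g_bound (hP : P.Admissible) :
    ∃ b, 0 ≤ b ∧ ∀ i k, ∀ x ∈ P.X i, ∀ s ∈ subdifferential (fun z => P.g i z k) x, ‖s‖ ≤ b := by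
  choose b hb using fun i k => (hP.proper_g i k).exists_subgradient_bound (hP.convex_g i k)
    (hP.compact_X i) (hP.g_domain i k)
  refine ⟨∑ i, ∑ k, |b i k|, by positivity, fun i k x hx s hs =>
    (hb i k x hx s hs).trans ((le_abs_self _).trans ?_)⟩
  exact (Finset.single_le_sum (f := fun k => |b i k|) (fun _ _ => abs_nonneg _)
    (Finset.mem_univ k)).trans (Finset.single_le_sum (f := fun i => ∑ k, |b i k|)
      (fun _ _ => by positivity) (Finset.mem_univ i))

theorem exists_diam_bound (hP : P.Admissible) :
    ∃ d, 0 ≤ d ∧ ∀ i, ∀ x ∈ P.X i, ∀ z ∈ P.X i, ‖x - z‖ ≤ d := by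
  choose b hb using fun i => (hP.compact_X i).isBounded.exists_norm_le
  refine ⟨∑ i, (|b i| + |b i|), by positivity, fun i x hx z hz => (norm_sub_le _ _).trans ?_⟩
  refine (add_le_add ((hb i x hx).trans (le_abs_self _))
    ((hb i z hz).trans (le_abs_self _))).trans ?_
  exact Finset.single_le_sum (f := fun i => |b i| + |b i|) (fun _ _ => by positivity)
    (Finset.mem_univ i)

/-- A best fixed decision in hindsight exists over every horizon. -/
theorem exists_isBestFixed (hP : P.Admissible) (T : ℕ) : ∃ z, P.IsBestFixed T z := by
  have hcpt : IsCompact (Set.univ.pi P.X) := isCompact_univ_pi hP.compact_X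
  have hg : ContinuousOn (fun z : ∀ i, E (P.n i) => ∑ i, P.gval i (z i)) (Set.univ.pi P.X) :=
    continuousOn_finsetSum _ fun i _ => (hP.continuousOn_gval i).comp
      (continuous_apply i).continuousOn fun z hz => hz i (Set.mem_univ i)
  have hf : ContinuousOn (P.fixedCost T) (Set.univ.pi P.X) :=
    continuousOn_finsetSum _ fun t _ => continuousOn_finsetSum _ fun i _ =>
      (hP.continuousOn_fval i t).comp (continuous_apply i).continuousOn
        fun z hz => hz i (Set.mem_univ i)
  have hclosed : IsClosed {v : E m | ∀ k, v k ≤ 0} := by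
    simp only [Set.ofPred_forall]
    exact isClosed_iInter fun k => isClosed_le (by fun_prop) continuous_const
  have heq : P.feasible = Set.univ.pi P.X ∩
      (fun z : ∀ i, E (P.n i) => ∑ i, P.gval i (z i)) ⁻¹' {v : E m | ∀ k, v k ≤ 0} := by
    ext z
    simp [feasible]
  have hfc : IsCompact P.feasible := by
    rw [heq]
    exact hcpt.of_isClosed_subset (hg.preimage_isClosed_of_isClosed hcpt.isClosed hclosed)
      Set.inter_subset_left
  obtain ⟨z, hz, hmin⟩ := hfc.exists_isMinOn hP.feasible_nonempty
    (hf.mono (heq ▸ Set.inter_subset_left))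
  exact ⟨z, hz, fun z' hz' => hmin hz'⟩

end Admissible

end Problem

/-! ### Invariants of the algorithm -/

namespace Run

open Network

variable {G : Network N} {P : Problem N m} {κ : ℝ} {T : ℕ}

theorem x_mem (r : Run G P κ T) : ∀ t, t ≤ T → ∀ i, r.x t i ∈ P.X i
  | 0, _, i => r.x_zero i
  | t + 1, ht, i => (r.x_succ t (by omega) i).1

/-- Unit row sums make the push-sum correction trivial, which removes every division by `w`. -/
theorem w_eq_one (hG : G.Admissible) (r : Run G P κ T) (t : ℕ) (ht : t ≤ T) (i : Fin N) :
    r.w t i = 1 := by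
  induction t generalizing i with
  | zero => exact r.w_zero i
  | succ t ih =>
    rw [r.w_succ t (by omega), ← hG.row_sum_eq_one t i]
    exact Finset.sum_congr rfl fun j _ => by rw [ih (by omega), mul_one]

theorem μ_nonneg (r : Run G P κ T) : ∀ t, t ≤ T → ∀ i k, 0 ≤ r.μ t i k
  | 0, _, i, k => by rw [r.μ_zero]; rfl
  | t + 1, ht, i, k => by rw [r.μ_succ t (by omega)]; exact le_max_right _ _

theorem μ_succ_eq (hG : G.Admissible) (r : Run G P κ T) (t : ℕ) (ht : t < T) (i : Fin N) :
    r.μ (t + 1) i = nonnegPart (G.mix t (r.μ t) i +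
      alpha t • (G.mix t (r.y t) i - beta κ t • G.mix t (r.μ t) i)) := by
  rw [r.μ_succ t ht, r.w_eq_one hG (t + 1) ht]
  simp

theorem s_mem (hG : G.Admissible) (r : Run G P κ T) (t : ℕ) (ht : t < T) (i : Fin N) :
    r.s (t + 1) i ∈ lagrangianSubgradients (P.f i t) (P.g i) (r.x t i) (G.mix t (r.μ t) i) := by
  have h := r.s_succ t ht i
  rwa [r.w_eq_one hG (t + 1) ht, inv_one, one_smul] at h

theorem sum_y (hG : G.Admissible) (r : Run G P κ T) (t : ℕ) (ht : t ≤ T) :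
    ∑ i, r.y t i = ∑ i, P.gval i (r.x t i) := by
  induction t with
  | zero => simp only [r.y_zero]
  | succ t ih =>
    rw [Finset.sum_congr rfl fun i _ => r.y_succ t (by omega) i, Finset.sum_sub_distrib,
      Finset.sum_add_distrib, sum_mix hG, ih (by omega)]
    abel

/-- The tracking variables are bounded, uniformly over all runs. -/
theorem exists_y_bound (hG : G.Admissible) (hP : P.Admissible) (κ : ℝ) :
    ∃ b, 0 ≤ b ∧ ∀ (T : ℕ) (r : Run G P κ T) (t : ℕ), t ≤ T → ∀ i, ‖r.y t i‖ ≤ b := by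
  obtain ⟨b, hb0, hb⟩ := hP.exists_gval_bound
  -- The perturbation `gᵢ(x_{t+1}) - gᵢ(x_t)` is only known to be bounded, by `2 b`, so the
  -- comparison sequence is constant.
  obtain ⟨K, hK0, hK⟩ := hG.exists_disagreement_bound (m := m) (h := fun _ => 1)
    (fun _ => one_pos) antitone_const (fun θ hθ B => ⟨0, fun _ _ => by linarith⟩)
    (r := b) (η := 2 * b) (by positivity) hb0
  refine ⟨K + b, by positivity, fun T r t ht i => ?_⟩
  have h1 := hK T r.y (fun i => by rw [r.y_zero]; exact hb i _ (r.x_zero i))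
    (fun t ht i => by
      rw [r.y_succ t ht, add_sub_assoc, add_sub_cancel_left]
      refine (norm_sub_le _ _).trans ?_
      linarith [hb i _ (r.x_mem (t + 1) ht i), hb i _ (r.x_mem t ht.le i)]) t ht i
  have h2 : ‖avg (r.y t)‖ ≤ b := by
    rw [avg, r.sum_y hG t ht]
    exact norm_avg_le hb0 fun i => hb i _ (r.x_mem t ht i)
  have h3 := norm_add_le (r.y t i - avg (r.y t)) (avg (r.y t))
  rw [sub_add_cancel] at h3
  linarith

section Bounds

variable {b : ℝ} (hG : G.Admissible) (hκ : 0 ≤ κ) (r : Run G P κ T)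
  (hy : ∀ t, t ≤ T → ∀ i, ‖r.y t i‖ ≤ b)

include hG hκ hy

/-- Before the positive part, the update is a convex combination of `μ̂` and `ŷ / β_t` with weight
`α_t β_t ≤ 1`, so the ball of radius `b / β_t` is preserved, and this radius grows with `t`. -/
theorem norm_μ_le (t : ℕ) (ht : t ≤ T) (i : Fin N) : ‖r.μ t i‖ ≤ b / beta κ t := by
  induction t generalizing i with
  | zero =>
    rw [r.μ_zero, norm_zero]
    exact div_nonneg ((norm_nonneg _).trans (hy 0 ht i)) (beta_pos 0).le
  | succ t ih =>
    have hα := alpha_pos t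
    have hβ := beta_pos (κ := κ) t
    have hb : 0 ≤ b := (norm_nonneg _).trans (hy _ ht i)
    have hαβ : alpha t * beta κ t ≤ 1 :=
      mul_le_one₀ (alpha_le_one t) hβ.le (beta_le_one hκ t)
    rw [r.μ_succ_eq hG t (by omega)]
    refine (norm_nonnegPart_le _).trans ?_
    have h1 := norm_mix_le hG t (ih (by omega)) i
    have h2 := norm_mix_le hG t (hy t (by omega)) i
    have h3 : G.mix t (r.μ t) i + alpha t • (G.mix t (r.y t) i - beta κ t • G.mix t (r.μ t) i)
        = (1 - alpha t * beta κ t) • G.mix t (r.μ t) i + alpha t • G.mix t (r.y t) i := by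
      module
    rw [h3]
    calc _ ≤ (1 - alpha t * beta κ t) * (b / beta κ t) + alpha t * b := by
          refine (norm_add_le _ _).trans (add_le_add ?_ ?_)
          · rw [norm_smul, Real.norm_of_nonneg (by linarith)]
            exact mul_le_mul_of_nonneg_left h1 (by linarith)
          · rw [norm_smul, Real.norm_of_nonneg hα.le]
            exact mul_le_mul_of_nonneg_left h2 hα.le
      _ = b / beta κ t := by field_simp; ring
      _ ≤ b / beta κ (t + 1) :=
          div_le_div_of_nonneg_left hb (beta_pos _) (beta_antitone hκ (Nat.le_succ t))

theorem norm_dual_direction_le (t : ℕ) (ht : t ≤ T) (i : Fin N) :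
    ‖G.mix t (r.y t) i - beta κ t • G.mix t (r.μ t) i‖ ≤ 2 * b := by
  have hβ := beta_pos (κ := κ) t
  have h1 := norm_mix_le hG t (r.norm_μ_le hG hκ hy t ht) i
  have h2 := norm_mix_le hG t (hy t ht) i
  refine (norm_sub_le _ _).trans ?_
  rw [norm_smul, Real.norm_of_nonneg hβ.le]
  rw [le_div_iff₀' hβ] at h1
  linarith

theorem norm_μ_succ_sub_mix_le (t : ℕ) (ht : t < T) (i : Fin N) :
    ‖r.μ (t + 1) i - G.mix t (r.μ t) i‖ ≤ 2 * b * alpha t := by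
  have h1 := norm_nonnegPart_sub_le (G.mix t (r.μ t) i +
    alpha t • (G.mix t (r.y t) i - beta κ t • G.mix t (r.μ t) i)) (G.mix t (r.μ t) i)
  rw [← r.μ_succ_eq hG t ht, nonnegPart_of_nonneg (mix_apply_nonneg t (r.μ_nonneg t ht.le) i),
    add_sub_cancel_left, norm_smul, Real.norm_of_nonneg (alpha_pos t).le] at h1
  have h2 := mul_le_mul_of_nonneg_left (r.norm_dual_direction_le hG hκ hy t ht.le i)
    (alpha_pos t).le
  linarith

theorem norm_s_le {Cf Cg : ℝ}
    (hCf : ∀ i t, ∀ x ∈ P.X i, ∀ s ∈ subdifferential (P.f i t) x, ‖s‖ ≤ Cf)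
    (hCg : ∀ i k, ∀ x ∈ P.X i, ∀ s ∈ subdifferential (fun z => P.g i z k) x, ‖s‖ ≤ Cg)
    (t : ℕ) (ht : t < T) (i : Fin N) : ‖r.s (t + 1) i‖ ≤ (|Cf| + m * b * Cg) / beta κ t := by
  obtain ⟨p, hp, q, hq, hs⟩ := r.s_mem hG t ht i
  have hx := r.x_mem t ht.le i
  have hβ := beta_pos (κ := κ) t
  have h1 := norm_mix_le hG t (r.norm_μ_le hG hκ hy t ht.le) i
  have h2 : ‖∑ k, G.mix t (r.μ t) i k • q k‖ ≤ m * (b / beta κ t * Cg) := by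
    calc _ ≤ ∑ k, ‖G.mix t (r.μ t) i k • q k‖ := norm_sum_le _ _
      _ ≤ ∑ _k : Fin m, (b / beta κ t * Cg) := by
          refine Finset.sum_le_sum fun k _ => ?_
          rw [norm_smul]
          exact mul_le_mul ((PiLp.norm_apply_le _ k).trans h1) (hCg i k _ hx _ (hq k))
            (norm_nonneg _) ((norm_nonneg _).trans h1)
      _ = _ := by simp
  -- Since `β_t ≤ 1`, the bounded cost part is absorbed into the order `1 / β_t`.
  have h3 : ‖p‖ ≤ |Cf| / beta κ t := by
    rw [le_div_iff₀ hβ]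
    have h4 := (hCf i t _ hx p hp).trans (le_abs_self Cf)
    have h5 := beta_le_one hκ t
    nlinarith [norm_nonneg p]
  rw [hs]
  refine (norm_add_le _ _).trans ((add_le_add h3 h2).trans_eq ?_)
  ring

end Bounds

/-- The disagreement of the dual variables is of the order of the stepsize. -/
theorem exists_μ_disagreement_bound (hG : G.Admissible) (P : Problem N m) (hκ : 0 ≤ κ) {b : ℝ}
    (hb : 0 ≤ b) : ∃ K, 0 ≤ K ∧ ∀ (T : ℕ) (r : Run G P κ T),
      (∀ t, t ≤ T → ∀ i, ‖r.y t i‖ ≤ b) →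
      ∀ t, t ≤ T → ∀ i, ‖r.μ t i - avg (r.μ t)‖ ≤ K * alpha t := by
  obtain ⟨K, hK0, hK⟩ := hG.exists_disagreement_bound (m := m) alpha_pos alpha_antitone alpha_slow
    (r := 0) (η := 2 * b) (by positivity) le_rfl
  exact ⟨K, hK0, fun T r hy => hK T r.μ (fun i => by rw [r.μ_zero, norm_zero])
    (r.norm_μ_succ_sub_mix_le hG hκ hy)⟩

end Run

namespace Run

open Network

variable {G : Network N} {P : Problem N m} {κ : ℝ} {T : ℕ}

/-! ### One-step inequalities -/

theorem primal_step (hG : G.Admissible) (hP : P.Admissible) (r : Run G P κ T) (t : ℕ) (ht : t < T)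
    (i : Fin N) {z : E (P.n i)} (hz : z ∈ P.X i) :
    2 * alpha t * (P.fval i t (r.x t i) - P.fval i t z
        + inner ℝ (G.mix t (r.μ t) i) (P.gval i (r.x t i) - P.gval i z))
      ≤ ‖r.x t i - z‖ ^ 2 - ‖r.x (t + 1) i - z‖ ^ 2 + alpha t ^ 2 * ‖r.s (t + 1) i‖ ^ 2 := by
  have hx := r.x_mem t ht.le i
  obtain ⟨p, hp, q, hq, hs⟩ := r.s_mem hG t ht i
  have h1 := (r.x_succ t ht i).norm_sub_sq_le (hP.convex_X i) hz
  have h2 := norm_sub_sq_real (r.x t i - z) (alpha t • r.s (t + 1) i)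
  rw [sub_right_comm, inner_smul_right, norm_smul, mul_pow, Real.norm_eq_abs, sq_abs] at h2
  have h3 : P.fval i t (r.x t i) - P.fval i t z ≤ inner ℝ p (r.x t i - z) := by
    have h := subgradient_toReal (hP.proper_f i t) (hP.f_lt_top i t hx) (hP.f_lt_top i t hz) hp
    rw [← neg_sub (r.x t i) z, inner_neg_right] at h
    simp only [Problem.fval]
    linarith
  have h4 : inner ℝ (G.mix t (r.μ t) i) (P.gval i (r.x t i) - P.gval i z)
      ≤ inner ℝ (∑ k, G.mix t (r.μ t) i k • q k) (r.x t i - z) := by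
    rw [sum_inner]
    simp only [PiLp.inner_apply (𝕜 := ℝ) (G.mix t (r.μ t) i)]
    refine Finset.sum_le_sum fun k _ => ?_
    have h := subgradient_toReal (hP.proper_g i k) (hP.g_lt_top i k hx) (hP.g_lt_top i k hz) (hq k)
    rw [← neg_sub (r.x t i) z, inner_neg_right] at h
    simp only [RCLike.inner_apply, conj_trivial, PiLp.sub_apply, Problem.gval_apply,
      inner_smul_left]
    rw [mul_comm]
    exact mul_le_mul_of_nonneg_left (by linarith) (mix_apply_nonneg t (r.μ_nonneg t ht.le) i k)
  have h5 : inner ℝ (r.s (t + 1) i) (r.x t i - z) = inner ℝ p (r.x t i - z)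
      + inner ℝ (∑ k, G.mix t (r.μ t) i k • q k) (r.x t i - z) := by
    rw [hs, inner_add_left]
  rw [real_inner_comm] at h5
  have h6 := mul_le_mul_of_nonneg_left (add_le_add h3 h4) (alpha_pos t).le
  rw [← h5] at h6
  linarith

theorem dual_step (hG : G.Admissible) (hκ : 0 ≤ κ) (r : Run G P κ T) {b : ℝ}
    (hy : ∀ t, t ≤ T → ∀ i, ‖r.y t i‖ ≤ b) (t : ℕ) (ht : t < T) (i : Fin N) {l : E m}
    (hl : ∀ k, 0 ≤ l k) :
    2 * alpha t * inner ℝ (G.mix t (r.y t) i) (l - G.mix t (r.μ t) i)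
      ≤ ‖G.mix t (r.μ t) i - l‖ ^ 2 - ‖r.μ (t + 1) i - l‖ ^ 2
        + 2 * alpha t * beta κ t * ‖l‖ ^ 2 + alpha t ^ 2 * (2 * b) ^ 2 := by
  set u := G.mix t (r.μ t) i with hu
  set v := G.mix t (r.y t) i with hv
  have hα := alpha_pos t
  have hβ := beta_pos (κ := κ) t
  have h1 : ‖r.μ (t + 1) i - l‖ ≤ ‖(u - l) + alpha t • (v - beta κ t • u)‖ := by
    have h := norm_nonnegPart_sub_le (u + alpha t • (v - beta κ t • u)) l
    rw [hu, hv, ← r.μ_succ_eq hG t ht, nonnegPart_of_nonneg hl, ← hu, ← hv] at h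
    rwa [add_sub_right_comm] at h
  have h2 := pow_le_pow_left₀ (norm_nonneg _) h1 2
  rw [norm_add_sq_real, inner_smul_right, norm_smul, mul_pow, Real.norm_eq_abs, sq_abs] at h2
  have h3 := pow_le_pow_left₀ (norm_nonneg _) (r.norm_dual_direction_le hG hκ hy t ht.le i) 2
  rw [← hu, ← hv] at h3
  have h4 := mul_le_mul_of_nonneg_left h3 (sq_nonneg (alpha t))
  have h5 : inner ℝ (u - l) (v - beta κ t • u)
      = -inner ℝ v (l - u) + beta κ t * (inner ℝ u l - ‖u‖ ^ 2) := by
    rw [inner_sub_right, inner_smul_right, inner_sub_left, inner_sub_left, inner_sub_right,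
      real_inner_self_eq_norm_sq, real_inner_comm l v, real_inner_comm u v, real_inner_comm l u]
    ring
  -- The price of regularization: its cross term costs only a multiple of `‖l‖²`, whatever the size
  -- of `u`.
  have h6 : inner ℝ u l - ‖u‖ ^ 2 ≤ ‖l‖ ^ 2 := by
    have := real_inner_le_norm u l
    nlinarith [sq_nonneg (‖u‖ - ‖l‖), sq_nonneg ‖u‖, sq_nonneg ‖l‖]
  have h7 := mul_le_mul_of_nonneg_left h6 (mul_nonneg hα.le hβ.le)
  rw [h5] at h2
  linarith

/-- The squared distance of the state at time `t` to a comparator `(z, l)`. -/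
noncomputable def potential (r : Run G P κ T) (z : ∀ i, E (P.n i)) (l : E m) (t : ℕ) : ℝ :=
  ∑ i, ‖r.x t i - z i‖ ^ 2 + ∑ i, ‖r.μ t i - l‖ ^ 2

theorem potential_nonneg (r : Run G P κ T) (z : ∀ i, E (P.n i)) (l : E m) (t : ℕ) :
    0 ≤ r.potential z l t := by
  unfold potential
  positivity

/-- The gap of the Lagrangian at time `t` between the multiplier `l` and the comparator `z`. -/
noncomputable def gap (r : Run G P κ T) (z : ∀ i, E (P.n i)) (l : E m) (t : ℕ) : ℝ :=
  ∑ i, (P.fval i t (r.x t i) - P.fval i t (z i)) + inner ℝ l (∑ i, P.gval i (r.x t i))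

/-- With a common multiplier the trackers would cancel against `∑ gᵢ(xᵢ)`, leaving the mean
multiplier against `∑ gᵢ(zᵢ) ≤ 0`. Only the disagreement of the multipliers, of order `α_t`,
remains. -/
theorem inner_mix_gval_le (hG : G.Admissible) (r : Run G P κ T) {bg b K : ℝ}
    (hbg : ∀ i, ∀ x ∈ P.X i, ‖P.gval i x‖ ≤ bg) (hy : ∀ t, t ≤ T → ∀ i, ‖r.y t i‖ ≤ b)
    (hμ : ∀ t, t ≤ T → ∀ i, ‖r.μ t i - avg (r.μ t)‖ ≤ K * alpha t) {z : ∀ i, E (P.n i)}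
    (hz : z ∈ P.feasible) (t : ℕ) (ht : t ≤ T) :
    ∑ i, inner ℝ (G.mix t (r.μ t) i)
        (G.mix t (r.y t) i - (P.gval i (r.x t i) - P.gval i (z i)))
      ≤ N * (K * (2 * bg + b)) * alpha t := by
  have hd : ∀ i, ‖G.mix t (r.μ t) i - avg (r.μ t)‖ ≤ K * alpha t := by
    intro i
    rw [← mix_sub_const hG]
    exact norm_mix_le hG t (hμ t ht) i
  have hsum : ∑ i, (G.mix t (r.y t) i - (P.gval i (r.x t i) - P.gval i (z i)))
      = ∑ i, P.gval i (z i) := by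
    rw [Finset.sum_sub_distrib, Finset.sum_sub_distrib, sum_mix hG, r.sum_y hG t ht]
    abel
  have havg : inner ℝ (avg (r.μ t)) (∑ i, P.gval i (z i)) ≤ 0 := by
    rw [PiLp.inner_apply]
    refine Finset.sum_nonpos fun k _ => ?_
    have h1 : 0 ≤ avg (r.μ t) k := by
      simp only [avg, PiLp.smul_apply, WithLp.ofLp_sum, Finset.sum_apply, smul_eq_mul]
      exact mul_nonneg (by positivity) (Finset.sum_nonneg fun i _ => r.μ_nonneg t ht i k)
    simp only [RCLike.inner_apply, conj_trivial]
    exact mul_nonpos_of_nonpos_of_nonneg (hz.2 k) h1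
  calc _ = inner ℝ (avg (r.μ t)) (∑ i, P.gval i (z i))
        + ∑ i, inner ℝ (G.mix t (r.μ t) i - avg (r.μ t))
          (G.mix t (r.y t) i - (P.gval i (r.x t i) - P.gval i (z i))) := by
        rw [← hsum, inner_sum, ← Finset.sum_add_distrib]
        refine Finset.sum_congr rfl fun i _ => ?_
        rw [inner_sub_left, add_sub_cancel]
    _ ≤ 0 + ∑ _i : Fin N, K * alpha t * (2 * bg + b) := by
        refine add_le_add havg (Finset.sum_le_sum fun i _ => (real_inner_le_norm _ _).trans ?_)
        refine mul_le_mul (hd i) ?_ (norm_nonneg _) ((norm_nonneg _).trans (hd i))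
        have h1 := norm_mix_le hG t (hy t ht) i
        have h2 := hbg i _ (r.x_mem t ht i)
        have h3 := hbg i _ (hz.1 i)
        have h4 := norm_sub_le (P.gval i (r.x t i)) (P.gval i (z i))
        have h5 := norm_sub_le (G.mix t (r.y t) i) (P.gval i (r.x t i) - P.gval i (z i))
        linarith
    _ = _ := by simp; ring

theorem descent (hG : G.Admissible) (hP : P.Admissible) (hκ : 0 ≤ κ) (r : Run G P κ T)
    {bg b bs K : ℝ}
    (hbg : ∀ i, ∀ x ∈ P.X i, ‖P.gval i x‖ ≤ bg) (hy : ∀ t, t ≤ T → ∀ i, ‖r.y t i‖ ≤ b)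
    (hμ : ∀ t, t ≤ T → ∀ i, ‖r.μ t i - avg (r.μ t)‖ ≤ K * alpha t)
    (hs : ∀ t, t < T → ∀ i, ‖r.s (t + 1) i‖ ≤ bs / beta κ t)
    {z : ∀ i, E (P.n i)} (hz : z ∈ P.feasible) {l : E m} (hl : ∀ k, 0 ≤ l k)
    (t : ℕ) (ht : t < T) :
    2 * alpha t * r.gap z l t ≤ r.potential z l t - r.potential z l (t + 1)
      + 2 * alpha t * (N * (bs ^ 2 / 2 * (alpha t / beta κ t ^ 2)
          + (2 * b ^ 2 + K * (2 * bg + b)) * alpha t) + N * ‖l‖ ^ 2 * beta κ t) := by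
  have hα := alpha_pos t
  have h1 : ∀ i, 2 * alpha t * (P.fval i t (r.x t i) - P.fval i t (z i)
        + inner ℝ (G.mix t (r.μ t) i) (P.gval i (r.x t i) - P.gval i (z i))
        + inner ℝ (G.mix t (r.y t) i) (l - G.mix t (r.μ t) i))
      ≤ (‖r.x t i - z i‖ ^ 2 - ‖r.x (t + 1) i - z i‖ ^ 2)
        + (‖G.mix t (r.μ t) i - l‖ ^ 2 - ‖r.μ (t + 1) i - l‖ ^ 2)
        + (alpha t ^ 2 * (bs / beta κ t) ^ 2
          + 2 * alpha t * beta κ t * ‖l‖ ^ 2 + alpha t ^ 2 * (2 * b) ^ 2) := by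
    intro i
    have h1 := r.primal_step hG hP t ht i (hz.1 i)
    have h2 := r.dual_step hG hκ hy t ht i hl
    have h3 := mul_le_mul_of_nonneg_left (pow_le_pow_left₀ (norm_nonneg _) (hs t ht i) 2)
      (sq_nonneg (alpha t))
    linarith
  have h2 := Finset.sum_le_sum fun i (_ : i ∈ Finset.univ) => h1 i
  rw [← Finset.mul_sum] at h2
  -- The terms with `l` become exact because `∑ ŷᵢ = ∑ yᵢ = ∑ gᵢ(xᵢ)`.
  have h3 : ∑ i, (P.fval i t (r.x t i) - P.fval i t (z i)
        + inner ℝ (G.mix t (r.μ t) i) (P.gval i (r.x t i) - P.gval i (z i))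
        + inner ℝ (G.mix t (r.y t) i) (l - G.mix t (r.μ t) i))
      = r.gap z l t - ∑ i, inner ℝ (G.mix t (r.μ t) i)
        (G.mix t (r.y t) i - (P.gval i (r.x t i) - P.gval i (z i))) := by
    rw [gap, ← r.sum_y hG t ht.le, ← sum_mix hG t (r.y t), inner_sum, ← Finset.sum_add_distrib,
      ← Finset.sum_sub_distrib]
    refine Finset.sum_congr rfl fun i _ => ?_
    rw [inner_sub_right (G.mix t (r.y t) i), inner_sub_right (G.mix t (r.μ t) i) (G.mix t (r.y t) i),
      real_inner_comm l, real_inner_comm (G.mix t (r.μ t) i) (G.mix t (r.y t) i)]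
    ring
  rw [h3, Finset.sum_add_distrib, Finset.sum_add_distrib, Finset.sum_const, Finset.card_univ,
    Fintype.card_fin, nsmul_eq_mul, Finset.sum_sub_distrib, Finset.sum_sub_distrib] at h2
  have h4 := mul_le_mul_of_nonneg_left (r.inner_mix_gval_le hG hbg hy hμ hz t ht.le)
    (mul_pos two_pos hα).le
  -- Replaces `μ̂` by `μ` in the distance to `l`, so that the potentials telescope.
  have h5 := sum_norm_mix_sub_sq_le hG t (r.μ t) l
  rw [div_pow] at h2
  unfold potential
  have h6 : alpha t ^ 2 * (bs ^ 2 / beta κ t ^ 2)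
      = alpha t * (bs ^ 2 * (alpha t / beta κ t ^ 2)) := by ring
  rw [h6] at h2
  linarith

theorem potential_le (hG : G.Admissible) (hκ : 0 ≤ κ) (r : Run G P κ T) {d b : ℝ}
    (hd : ∀ i, ∀ x ∈ P.X i, ∀ z ∈ P.X i, ‖x - z‖ ≤ d) (hy : ∀ t, t ≤ T → ∀ i, ‖r.y t i‖ ≤ b)
    {z : ∀ i, E (P.n i)} (hz : ∀ i, z i ∈ P.X i) (l : E m) (t : ℕ) (ht : t ≤ T) :
    r.potential z l t ≤ N * ((d ^ 2 + 2 * b ^ 2) / beta κ t ^ 2 + 2 * ‖l‖ ^ 2) := by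
  have hβ := beta_pos (κ := κ) t
  have h1 : d ^ 2 ≤ d ^ 2 / beta κ t ^ 2 :=
    le_div_self (sq_nonneg d) (by positivity) (pow_le_one₀ hβ.le (beta_le_one hκ t))
  unfold potential
  rw [← Finset.sum_add_distrib]
  calc _ ≤ ∑ _i : Fin N, ((d ^ 2 + 2 * b ^ 2) / beta κ t ^ 2 + 2 * ‖l‖ ^ 2) := by
        refine Finset.sum_le_sum fun i _ => ?_
        have h2 := pow_le_pow_left₀ (norm_nonneg _) (hd i _ (r.x_mem t ht i) _ (hz i)) 2
        have h3 := pow_le_pow_left₀ (norm_nonneg _) (r.norm_μ_le hG hκ hy t ht i) 2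
        have h4 := pow_le_pow_left₀ (norm_nonneg _) (norm_sub_le (r.μ t i) l) 2
        have h5 : (‖r.μ t i‖ + ‖l‖) ^ 2 ≤ 2 * ‖r.μ t i‖ ^ 2 + 2 * ‖l‖ ^ 2 := by
          nlinarith [sq_nonneg (‖r.μ t i‖ - ‖l‖)]
        rw [div_pow] at h3
        rw [add_div, mul_div_assoc]
        linarith
    _ = _ := by simp; ring

end Run

/-! ### Regret and constraint violation -/

theorem sum_alpha_div_beta_sq_le (n : ℕ) :
    ∑ t ∈ Icc 1 n, alpha t / beta (1 / 5) t ^ 2 ≤ 2 * (n : ℝ) ^ (9 / 10 : ℝ) := by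
  have h1 := sum_rpow_sub_one_le (p := 9 / 10) (by norm_num) (by norm_num) n
  have h2 : ∑ t ∈ Icc 1 n, alpha t / beta (1 / 5) t ^ 2
      = ∑ t ∈ Icc 1 n, (t : ℝ) ^ ((9 / 10 : ℝ) - 1) := by
    refine Finset.sum_congr rfl fun t ht => ?_
    rw [alpha_div_beta_sq (Finset.mem_Icc.1 ht).1]
    norm_num
  have h3 : (0 : ℝ) ≤ (n : ℝ) ^ (9 / 10 : ℝ) := by positivity
  rw [h2]
  linarith

theorem sum_beta_le (n : ℕ) : ∑ t ∈ Icc 1 n, beta (1 / 5) t ≤ 2 * (n : ℝ) ^ (4 / 5 : ℝ) := by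
  have h1 := sum_rpow_sub_one_le (p := 4 / 5) (by norm_num) (by norm_num) n
  have h2 : ∑ t ∈ Icc 1 n, beta (1 / 5) t = ∑ t ∈ Icc 1 n, (t : ℝ) ^ ((4 / 5 : ℝ) - 1) := by
    refine Finset.sum_congr rfl fun t ht => ?_
    rw [beta_of_pos (Finset.mem_Icc.1 ht).1]
    norm_num
  have h3 : (0 : ℝ) ≤ (n : ℝ) ^ (4 / 5 : ℝ) := by positivity
  rw [h2]
  linarith

namespace Run

theorem sum_gap {G : Network N} {P : Problem N m} {κ : ℝ} {T : ℕ} (r : Run G P κ T)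
    (z : ∀ i, E (P.n i)) (l : E m) :
    ∑ t ∈ Icc 1 T, r.gap z l t
      = P.regret T r.x z + inner ℝ l (∑ t ∈ Icc 1 T, ∑ i, P.gval i (r.x t i)) := by
  simp only [gap, Problem.regret, Problem.fixedCost, Finset.sum_add_distrib,
    Finset.sum_sub_distrib, inner_sum]

/-- A crude bound for the final time `T`, from which no step is taken. The form `1 + ‖l‖²` fits the
accumulated estimate. -/
theorem gap_le {G : Network N} {P : Problem N m} {κ : ℝ} {T : ℕ} (r : Run G P κ T) {bf bg : ℝ}
    (hbf : ∀ i t, ∀ x ∈ P.X i, |P.fval i t x| ≤ bf)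
    (hbg : ∀ i, ∀ x ∈ P.X i, ‖P.gval i x‖ ≤ bg) {z : ∀ i, E (P.n i)} (hz : ∀ i, z i ∈ P.X i)
    (l : E m) (t : ℕ) (ht : t ≤ T) :
    r.gap z l t ≤ N * (2 * bf) + N * bg * (1 + ‖l‖ ^ 2) := by
  refine add_le_add ?_ ?_
  · calc _ ≤ ∑ _i : Fin N, 2 * bf := Finset.sum_le_sum fun i _ => by
          linarith [(abs_le.1 (hbf i t _ (r.x_mem t ht i))).2, (abs_le.1 (hbf i t _ (hz i))).1]
      _ = _ := by simp
  · have h1 : ‖∑ i, P.gval i (r.x t i)‖ ≤ N * bg := by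
      calc _ ≤ ∑ i, ‖P.gval i (r.x t i)‖ := norm_sum_le _ _
        _ ≤ ∑ _i : Fin N, bg := Finset.sum_le_sum fun i _ => hbg i _ (r.x_mem t ht i)
        _ = _ := by simp
    have h2 : ‖l‖ ≤ 1 + ‖l‖ ^ 2 := by nlinarith [sq_nonneg (‖l‖ - 1)]
    calc _ ≤ ‖l‖ * ‖∑ i, P.gval i (r.x t i)‖ := real_inner_le_norm _ _
      _ ≤ (1 + ‖l‖ ^ 2) * (N * bg) := mul_le_mul h2 h1 (norm_nonneg _) (by positivity)
      _ = _ := by ring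

/-- The accumulated Lagrangian gap, uniformly over horizons, runs, comparators and multipliers. -/
theorem exists_lagrangian_bound {G : Network N} {P : Problem N m} (hG : G.Admissible)
    (hP : P.Admissible) :
    ∃ K : ℝ, 0 < K ∧ ∀ T : ℕ, 1 ≤ T → ∀ r : Run G P (1 / 5) T, ∀ z ∈ P.feasible,
      ∀ l : E m, (∀ k, 0 ≤ l k) →
      P.regret T r.x z + inner ℝ l (∑ t ∈ Icc 1 T, ∑ i, P.gval i (r.x t i))
        ≤ K * ((T : ℝ) ^ (9 / 10 : ℝ) + ‖l‖ ^ 2 * (T : ℝ) ^ (4 / 5 : ℝ)) := by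
  have hκ : (0 : ℝ) ≤ 1 / 5 := by norm_num
  obtain ⟨bg, hbg0, hbg⟩ := hP.exists_gval_bound
  obtain ⟨Cg, hCg0, hCg⟩ := hP.exists_subgradient_g_bound
  obtain ⟨d, hd0, hd⟩ := hP.exists_diam_bound
  obtain ⟨bf, hbf⟩ := hP.bounded_f
  obtain ⟨Cf, hCf⟩ := hP.bounded_subgradient_f
  obtain ⟨b, hb0, hb⟩ := exists_y_bound hG hP (1 / 5)
  obtain ⟨K, hK0, hK⟩ := exists_μ_disagreement_bound (κ := 1 / 5) hG P hκ hb0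
  set bs := |Cf| + m * b * Cg with hbs
  set c := (d ^ 2 + 2 * b ^ 2) / 2 + bs ^ 2 / 2 + (2 * b ^ 2 + K * (2 * bg + b)) with hc
  have hc0 : 0 ≤ c := by positivity
  refine ⟨1 + N * (2 * c + 4 + 2 * |bf| + bg), by positivity, fun T hT r z hz l hl => ?_⟩
  -- Descent is available at times `1, …, n` only; time `n + 1` is handled by `gap_le`.
  obtain ⟨n, rfl⟩ : ∃ n, T = n + 1 := ⟨T - 1, by omega⟩
  have hy := hb (n + 1) r
  have hstep := r.descent hG hP hκ hbg hy (hK (n + 1) r hy)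
    (r.norm_s_le hG hκ hy hCf hCg) hz hl
  have h1 := sum_le_of_descent (n := n) (r.potential_nonneg z l)
    (fun t _ ht => r.potential_le hG hκ hd hy hz.1 l t (by omega))
    (fun t _ ht => hstep t (by omega))
  have h2 : ∑ t ∈ Icc 1 n, (alpha t * (N * ((d ^ 2 + 2 * b ^ 2) / beta (1 / 5) t ^ 2
        + 2 * ‖l‖ ^ 2)) / 2 + (N * (bs ^ 2 / 2 * (alpha t / beta (1 / 5) t ^ 2)
          + (2 * b ^ 2 + K * (2 * bg + b)) * alpha t) + N * ‖l‖ ^ 2 * beta (1 / 5) t))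
      ≤ N * c * ∑ t ∈ Icc 1 n, alpha t / beta (1 / 5) t ^ 2
        + 2 * (N * ‖l‖ ^ 2) * ∑ t ∈ Icc 1 n, beta (1 / 5) t := by
    rw [Finset.mul_sum, Finset.mul_sum, ← Finset.sum_add_distrib]
    refine Finset.sum_le_sum fun t _ => ?_
    have hα := alpha_pos t
    have hβ := beta_pos (κ := 1 / 5) t
    have h3 : alpha t ≤ alpha t / beta (1 / 5) t ^ 2 :=
      le_div_self hα.le (by positivity) (pow_le_one₀ hβ.le (beta_le_one hκ t))
    -- Merges the contribution `‖l‖² α_t` of the potential with the regularization error `‖l‖² β_t`.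
    have h4 : alpha t ≤ beta (1 / 5) t := alpha_le_beta (by norm_num) t
    have h5 := mul_le_mul_of_nonneg_left h3
      (by positivity : (0 : ℝ) ≤ N * (2 * b ^ 2 + K * (2 * bg + b)))
    have h6 := mul_le_mul_of_nonneg_left h4 (by positivity : (0 : ℝ) ≤ N * ‖l‖ ^ 2)
    have h7 : alpha t * (N * ((d ^ 2 + 2 * b ^ 2) / beta (1 / 5) t ^ 2 + 2 * ‖l‖ ^ 2)) / 2
        = N * ((d ^ 2 + 2 * b ^ 2) / 2) * (alpha t / beta (1 / 5) t ^ 2)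
          + N * ‖l‖ ^ 2 * alpha t := by ring
    rw [h7, hc]
    linarith
  have h3 := r.gap_le hbf hbg hz.1 l (n + 1) le_rfl
  have hmono : ∀ p : ℝ, 0 ≤ p → (n : ℝ) ^ p ≤ ((n + 1 : ℕ) : ℝ) ^ p := fun p hp =>
    Real.rpow_le_rpow (Nat.cast_nonneg n) (by push_cast; linarith) hp
  have h4 := mul_le_mul_of_nonneg_left ((sum_alpha_div_beta_sq_le n).trans
    (mul_le_mul_of_nonneg_left (hmono (9 / 10) (by norm_num)) zero_le_two))
    (by positivity : (0 : ℝ) ≤ N * c)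
  have h5 := mul_le_mul_of_nonneg_left ((sum_beta_le n).trans
    (mul_le_mul_of_nonneg_left (hmono (4 / 5) (by norm_num)) zero_le_two))
    (by positivity : (0 : ℝ) ≤ 2 * (N * ‖l‖ ^ 2))
  have hone : ∀ p : ℝ, 0 ≤ p → 1 ≤ ((n + 1 : ℕ) : ℝ) ^ p := fun p hp =>
    Real.one_le_rpow (by push_cast; linarith [(Nat.cast_nonneg n : (0 : ℝ) ≤ n)]) hp
  have hA := hone (9 / 10) (by norm_num)
  have hB := hone (4 / 5) (by norm_num)
  rw [← r.sum_gap z l, Finset.sum_Icc_succ_top (by omega)]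
  set A := ((n + 1 : ℕ) : ℝ) ^ (9 / 10 : ℝ)
  set B := ((n + 1 : ℕ) : ℝ) ^ (4 / 5 : ℝ)
  have hN : (0 : ℝ) ≤ N := Nat.cast_nonneg N
  have h6 : N * (2 * bf) + N * bg ≤ N * (2 * |bf| + bg) * A := by
    have h7 : N * (2 * bf) ≤ N * (2 * |bf|) :=
      mul_le_mul_of_nonneg_left (by linarith [le_abs_self bf]) hN
    have h8 : (0 : ℝ) ≤ N * (2 * |bf| + bg) := by positivity
    nlinarith
  have h7 : N * bg * ‖l‖ ^ 2 ≤ N * bg * ‖l‖ ^ 2 * B :=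
    le_mul_of_one_le_right (by positivity) hB
  have h8 : 0 ≤ (1 + N * 4 : ℝ) * A := by positivity
  have h9 : 0 ≤ (1 + N * (2 * c + 2 * |bf|)) * (‖l‖ ^ 2 * B) := by positivity
  linarith

end Run

end DistOnline

/-! ### Choice of the multiplier. -/

theorem corollary1 {N m : ℕ} (G : DistOnline.Network N) (P : DistOnline.Problem N m)
    (hG : G.Admissible) (hP : P.Admissible) :
    ∃ C : ℝ, 0 < C ∧ ∀ T : ℕ, 4 ≤ T →
      (∃ xs, P.IsBestFixed T xs) ∧
      ∀ r : DistOnline.Run G P (1 / 5) T,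
        (∀ xs, P.IsBestFixed T xs → P.regret T r.x xs ≤ C * (T : ℝ) ^ (9 / 10 : ℝ)) ∧
        P.violation T r.x ≤ C * (T : ℝ) ^ (9 / 10 : ℝ) := by
  obtain ⟨K, hK0, hK⟩ := DistOnline.Run.exists_lagrangian_bound hG hP
  obtain ⟨bf, hbf⟩ := hP.bounded_f
  obtain ⟨z, hz⟩ := hP.feasible_nonempty
  refine ⟨2 * (K + N * (2 * |bf|)), by positivity, fun T hT =>
    ⟨hP.exists_isBestFixed T, fun r => ?_⟩⟩
  have hT0 : (1 : ℝ) ≤ T := by exact_mod_cast (by omega : 1 ≤ T)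
  have hTpos : (0 : ℝ) < T := by linarith
  have hA : 0 < (T : ℝ) ^ (9 / 10 : ℝ) := by positivity
  have hB : 0 < (T : ℝ) ^ (4 / 5 : ℝ) := by positivity
  constructor
  · intro xs hxs
    have h := hK T (by omega) r xs hxs.1 0 (fun k => le_rfl)
    rw [inner_zero_left, norm_zero] at h
    have h2 : 0 ≤ (K + 2 * (N * (2 * |bf|))) * (T : ℝ) ^ (9 / 10 : ℝ) := by positivity
    nlinarith
  · have hreg : -(N * (2 * |bf|) * T) ≤ P.regret T r.x z := by
      simp only [DistOnline.Problem.regret, DistOnline.Problem.fixedCost,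
        ← Finset.sum_sub_distrib]
      calc -(N * (2 * |bf|) * T) = ∑ _t ∈ Finset.Icc 1 T, ∑ _i : Fin N, -(2 * |bf|) := by
            simp; ring
        _ ≤ _ := Finset.sum_le_sum fun t ht => Finset.sum_le_sum fun i _ => by
            linarith [(abs_le.1 (hbf i t _ (r.x_mem t (Finset.mem_Icc.1 ht).2 i))).1,
              (abs_le.1 (hbf i t _ (hz.1 i))).2, le_abs_self bf]
    unfold DistOnline.Problem.violation
    set S := ∑ t ∈ Finset.Icc 1 T, ∑ i, P.gval i (r.x t i) with hS
    set v := DistOnline.nonnegPart S with hv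
    set A := (T : ℝ) ^ (9 / 10 : ℝ) with hAdef
    set B := (T : ℝ) ^ (4 / 5 : ℝ) with hBdef
    have hAT : A ≤ T := by
      calc A ≤ (T : ℝ) ^ (1 : ℝ) := Real.rpow_le_rpow_of_exponent_le hT0 (by norm_num)
        _ = T := Real.rpow_one _
    -- The exponents balance: `1 + 4/5 = 2 · 9/10`.
    have hTB : T * B = A ^ 2 := by
      rw [hAdef, hBdef, ← Real.rpow_natCast, ← Real.rpow_mul hTpos.le]
      nth_rewrite 1 [← Real.rpow_one (T : ℝ)]
      rw [← Real.rpow_add hTpos]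
      norm_num
    -- Maximizes `a ‖v‖² - K B a² ‖v‖²`: the quadratic penalty then takes exactly half of the linear
    -- term.
    set a := 1 / (2 * K * B) with ha
    have ha0 : 0 < a := by positivity
    have h := hK T (by omega) r z hz (a • v) (fun k => by
      simp only [PiLp.smul_apply, smul_eq_mul]
      exact mul_nonneg ha0.le (le_max_right _ _))
    rw [← hS, inner_smul_left, conj_trivial, hv, DistOnline.inner_nonnegPart_self, ← hv, norm_smul,
      mul_pow, Real.norm_eq_abs, sq_abs] at h
    have haK : a * (2 * K * B) = 1 := by
      rw [ha, one_div_mul_cancel (by positivity)]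
    have h1 : a * ‖v‖ ^ 2 ≤ 2 * ((K + N * (2 * |bf|)) * T) := by
      have h2 : K * (a ^ 2 * ‖v‖ ^ 2 * B) = a * ‖v‖ ^ 2 / 2 := by
        linear_combination (a * ‖v‖ ^ 2 / 2) * haK
      have h3 : K * A ≤ K * T := mul_le_mul_of_nonneg_left hAT hK0.le
      linarith
    have h4 : ‖v‖ ^ 2 ≤ 4 * K * (K + N * (2 * |bf|)) * A ^ 2 := by
      have h5 := mul_le_mul_of_nonneg_right h1 (by positivity : (0 : ℝ) ≤ 2 * K * B)
      rw [← hTB]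
      have h6 : a * ‖v‖ ^ 2 * (2 * K * B) = ‖v‖ ^ 2 := by
        linear_combination ‖v‖ ^ 2 * haK
      linarith
    refine le_of_sq_le_sq ?_ (by positivity)
    have h7 : 4 * K * (K + N * (2 * |bf|)) ≤ (2 * (K + N * (2 * |bf|))) ^ 2 := by
      have h8 : (0 : ℝ) ≤ N * (2 * |bf|) := by positivity
      nlinarith
    rw [mul_pow]
    exact h4.trans (mul_le_mul_of_nonneg_right h7 (sq_nonneg A))
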